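/- **Theorem (almost sure convergence under asymptotic tightness).** Let $(\Omega,\mathcal F,P)$ be a probability space with a filtration $(\mathcal F_n)_{n\ge 0}$, and let $\theta_n$, $Y_n$ ($n\ge 0$) and $M_n$ ($n\ge 1$) be adapted $\mathbb R^d$-valued random variables with $$\theta_{n+1}=\theta_n+a(n)\,[\,f(\theta_n,Y_n)+M_{n+1}\,],\qquad n\ge 0,$$ where $f:\mathbb R^d\times\mathbb R^d\to\mathbb R^d$ is measurable, $(M_n)$ is a martingale difference sequence with respect to $(\mathcal F_n)$, and $P(Y_{n+1}\in A\mid\mathcal F_n)=\Pi_{\theta_n}(Y_n;A)$ a.s. for all $n$ and all Borel sets $A$, for transition probability kernels $\Pi_\theta(y;dz)$ on $\mathbb R^d$ that are jointly measurable in $(\theta,y)$. Assume: - (A1) there is a constant $\bar C$ with $\limsup_n\|Y_n\|<\bar C$ a.s., and $\limsup_n E\|Y_n\|^2<\infty$; - (A2) there is $K$ with $\sup_y\|f(\theta,y)\|\le K(1+\|\theta\|)$ for all $\theta$; - (A3) $a(n)>0$ is non-increasing, $\sum_n a(n)=\infty$, $\sum_n a(n)^2<\infty$; - (A4) for every $\theta$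 the kernel $\Pi_\theta$ has a unique invariant probability measure $\Gamma_\theta$, and $h(\theta)=\int f(\theta,y)\,\Gamma_\theta(dy)$ is Lipschitz continuous; - (A5) there is $K'$ with $\|M_{n+1}\|\le K'(1+\|\theta_n\|)$ a.s. for all $n$; - (A6) for every $\theta$ the Poisson equation $v_\theta(y)-\int v_\theta(z)\,\Pi_\theta(y;dz)=f(\theta,y)-h(\theta)$ (for all $y$) has a measurable solution $v_\theta:\mathbb R^d\to\mathbb R^d$, integrable with respect to every $\Pi_\theta(y;\cdot)$; - (A7) these solutions can be chosen so that for every $R>0$ there is $C_R>0$ such that, for all $x$ and all $\theta,\theta'$ of norm at most $R$, $\|v_\theta(x)\|\le C_R(1+\|x\|)$ and $\|v_\theta(x)-v_{\theta'}(x)\|\le C_R\|\theta-\theta'\|(1+\|x\|)$. Let $G\subset\mathbb R^d$ be open and let $V:G\to[0,\infty)$ be differentiable with $\langle\nabla V,h\rangle\le 0$ on $G$. Suppose that $H:=\{\theta\in G:V(\theta)=0\}$ is compact and equals $\{\theta\in G:\langle\nabla V(\theta),h(\theta)\rangle=0\}$, and that $G$ is contained in (for instance, equal to) the domain of attraction of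 $H$, i.e. every solution of $\dot\theta(t)=h(\theta(t))$, $t\ge 0$, with $\theta(0)\in G$ satisfies $\operatorname{dist}(\theta(t),H)\to 0$ as $t\to\infty$. Suppose that $(\theta_n)$ is asymptotically tight in the following sense: for every $\epsilon>0$ there is a compact set $K_\epsilon\subset\mathbb R^d$ such that $\overline{K_\epsilon\cap G}\subset G$ (a void condition if $G=\mathbb R^d$) and $$\limsup_{n\to\infty}P(\theta_n\in K_\epsilon)\ge 1-\epsilon .$$ If moreover $\liminf_{n\to\infty}P(\theta_n\in G)=1$, then $P(\theta_n\to H)=1$, i.e. $\operatorname{dist}(\theta_n,H)\to 0$ almost surely. -/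

import Mathlib

open MeasureTheory ProbabilityTheory Filter Topology
open scoped ENNReal NNReal

namespace StochApprox

/-- `π` is an invariant probability measure of the transition kernel `κ`. -/
def IsInvariantProb {S : Type*} [MeasurableSpace S] (κ : Kernel S S) (π : Measure S) : Prop :=
  IsProbabilityMeasure π ∧ Kernel.Invariant κ π

/-- `x(s) → H` along the filter `l`, i.e. `dist(x(s), H) → 0`
(the extended distance to the empty set is `∞`, so nothing converges to `∅`). -/
def ConvergesTo {ι E : Type*} [PseudoEMetricSpace E] (x : ι → E) (l : Filter ι) (H : Set E) :
    Prop :=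
  Tendsto (fun s => Metric.infEDist (x s) H) l (𝓝 0)

/-- The domain of attraction of `H` for the differential equation `x' = h(x)`: the initial points
of forward solutions that converge to `H`. -/
def domainOfAttraction {E : Type*} [NormedAddCommGroup E] [NormedSpace ℝ E] (h : E → E)
    (H : Set E) : Set E :=
  {x₀ | ∃ x : ℝ → E, x 0 = x₀ ∧
    (∀ t, 0 ≤ t → HasDerivWithinAt x (h (x t)) (Set.Ici 0) t) ∧ ConvergesTo x atTop H}

/-- `V : G → [0, ∞)` is a strict Lyapunov function on the open set `G` for `x' = h(x)`, whose zero
set in `G` is the compact set `H`. -/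
structure IsStrictLyapunov {E : Type*} [NormedAddCommGroup E] [InnerProductSpace ℝ E]
    [CompleteSpace E] (h : E → E) (G : Set E) (V : E → ℝ) (H : Set E) : Prop where
  isOpen : IsOpen G
  differentiableOn : DifferentiableOn ℝ V G
  nonneg : ∀ x ∈ G, 0 ≤ V x
  nonpos : ∀ x ∈ G, inner ℝ (gradient V x) (h x) ≤ 0
  eq_zeros : H = {x ∈ G | V x = 0}
  eq_critical : H = {x ∈ G | inner ℝ (gradient V x) (h x) = 0}
  isCompact : IsCompact H

/-- Asymptotic tightness relative to `G`: for every `ε > 0` there is a compact set `K` with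
`limsup P(θₙ ∈ K) ≥ 1 - ε`, whose part in `G` does not accumulate at the boundary of `G`.
For `G` the whole space the condition on the closure is void. -/
def AsymptoticallyTightIn {Ω E : Type*} [MeasurableSpace Ω] [TopologicalSpace E]
    (P : Measure Ω) (θ : ℕ → Ω → E) (G : Set E) : Prop :=
  ∀ ε : ℝ, 0 < ε → ∃ K : Set E, IsCompact K ∧ closure (K ∩ G) ⊆ G ∧
    1 - ε ≤ limsup (fun n => P.real {ω | θ n ω ∈ K}) atTop

/-- The sequence `M 1, M 2, …` is a martingale difference sequence for the filtration `ℱ`. -/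
def IsMartingaleDifference {Ω E : Type*} {m₀ : MeasurableSpace Ω} [NormedAddCommGroup E]
    [NormedSpace ℝ E] [CompleteSpace E] (P : Measure Ω) (ℱ : Filtration ℕ m₀) (M : ℕ → Ω → E) :
    Prop :=
  ∀ n, StronglyMeasurable[ℱ (n + 1)] (M (n + 1)) ∧ Integrable (M (n + 1)) P ∧
    P[M (n + 1) | ℱ n] =ᵐ[P] 0

/-- `Y` is Markov iterate-dependent noise: given the past up to time `n`, the law of `Y (n + 1)`
is `Π_{θₙ}(Yₙ; ·)`, where `Q (ϑ, y)` stands for `Π_ϑ(y; ·)`. -/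
def IsIterateDependentMarkov {Ω E S : Type*} {m₀ : MeasurableSpace Ω} [MeasurableSpace E]
    [MeasurableSpace S] (P : Measure Ω) (ℱ : Filtration ℕ m₀) (Q : Kernel (E × S) S)
    (θ : ℕ → Ω → E) (Y : ℕ → Ω → S) : Prop :=
  ∀ n, ∀ A : Set S, MeasurableSet A →
    P[(Y (n + 1) ⁻¹' A).indicator (fun _ => (1 : ℝ)) | ℱ n]
      =ᵐ[P] fun ω => (Q (θ n ω, Y n ω)).real A

/-- `v` solves the Poisson equation `(1 - κ) v = g`, where `κ v (y) = ∫ v(z) κ(y; dz)`. -/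
def SolvesPoisson {S E : Type*} [MeasurableSpace S] [NormedAddCommGroup E] [NormedSpace ℝ E]
    [MeasurableSpace E] (κ : Kernel S S) (g v : S → E) : Prop :=
  Measurable v ∧ ∀ y, Integrable v (κ y) ∧ v y - ∫ z, v z ∂(κ y) = g y

end StochApprox

/-! Stability of the iterates is not assumed, so every noise estimate is localised by a cut-off in
θ. The Poisson equation splits f(θᵢ, Yᵢ) - h(θᵢ) into the prediction error v(θᵢ, Yᵢ₊₁) - Πv(θᵢ, Yᵢ),
a martingale difference, and v(θᵢ, Yᵢ) - v(θᵢ, Yᵢ₊₁), which is summed by parts because θ moves by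
O(a(i)) inside a ball. As the squared steps are summable, the localised weighted noise sums converge
almost surely for every radius (`ae_cauchySeq_sum_localised_noise`).

On such a path the argument is deterministic. By Gronwall, a late enough passage near the start of
an ODE solution is followed by tracking over a finite horizon (`euler_scheme_tracks_solution`);
tracking itself keeps the path in a ball, so the cut-off is invisible. A path returning infinitely
often to a compact part of G has a limit point there, hence follows a solution into a low sublevel
set of V near H. It cannot escape infinitely often: a limit of the starting points of escapes would
be the start of a solution that stays in a larger sublevel set and becomes low again
(`euler_scheme_convergesTo`).

Tightness only supplies recurrence. Avoiding a compact set from time N on is no likelier than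
avoiding it at one single n ≥ N, so control of the laws along a subsequence, which is what the
limsup gives, suffices (`exists_compact_measure_not_frequently_le`). -/

namespace StochApprox

/-! ### Lipschitz cut-off. -/

section Cutoff

variable {E : Type*} [NormedAddCommGroup E]

/-- A Lipschitz cut-off function: `1` on the ball of radius `R`, `0` outside the ball of radius
`R + 1`. -/
def cutoff (R : ℝ) (x : E) : ℝ := max 0 (min 1 (R + 1 - ‖x‖))

lemma cutoff_nonneg (R : ℝ) (x : E) : 0 ≤ cutoff R x := le_max_left _ _

lemma cutoff_le_one (R : ℝ) (x : E) : cutoff R x ≤ 1 :=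
  max_le zero_le_one (min_le_left _ _)

lemma cutoff_eq_one {R : ℝ} {x : E} (hx : ‖x‖ ≤ R) : cutoff R x = 1 := by
  unfold cutoff
  rw [min_eq_left (by linarith), max_eq_right zero_le_one]

lemma cutoff_eq_zero {R : ℝ} {x : E} (hx : R + 1 ≤ ‖x‖) : cutoff R x = 0 := by
  unfold cutoff
  exact max_eq_left ((min_le_right _ _).trans (by linarith))

lemma abs_cutoff_sub_le (R : ℝ) (x y : E) : |cutoff R x - cutoff R y| ≤ ‖x - y‖ := by
  unfold cutoff
  refine (abs_max_sub_max_le_max _ _ _ _).trans (max_le (by simp) ?_)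
  refine (abs_min_sub_min_le_max _ _ _ _).trans (max_le (by simp) ?_)
  rw [show R + 1 - ‖x‖ - (R + 1 - ‖y‖) = ‖y‖ - ‖x‖ by ring, norm_sub_rev x y]
  exact abs_norm_sub_norm_le y x

lemma continuous_cutoff (R : ℝ) : Continuous (cutoff R : E → ℝ) := by
  unfold cutoff
  fun_prop

end Cutoff

/-! ### Local error of the Euler method. -/

section ODE

variable {E : Type*} [NormedAddCommGroup E] [NormedSpace ℝ E]

/-- First-order Taylor bound for a solution of `x' = h(x)` with `h` Lipschitz. -/
lemma norm_euler_step_sub_le {h : E → E} {L : ℝ≥0} (hL : LipschitzWith L h) {φ : ℝ → E}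
    (hφ : ∀ t, 0 ≤ t → HasDerivWithinAt φ (h (φ t)) (Set.Ici 0) t) {T B : ℝ}
    (hB : ∀ t ∈ Set.Icc 0 T, ‖h (φ t)‖ ≤ B) {s α : ℝ} (hs : 0 ≤ s) (hα : 0 ≤ α)
    (hsα : s + α ≤ T) :
    ‖φ (s + α) - φ s - α • h (φ s)‖ ≤ L * B * α ^ 2 := by
  have hsub : Set.Icc s (s + α) ⊆ Set.Ici (0 : ℝ) := fun u hu => hs.trans hu.1
  have hd : ∀ u ∈ Set.Icc s (s + α), HasDerivWithinAt φ (h (φ u)) (Set.Icc s (s + α)) u :=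
    fun u hu => (hφ u (hsub hu)).mono hsub
  have hsmem : s ∈ Set.Icc s (s + α) := ⟨le_rfl, by linarith⟩
  have hemem : s + α ∈ Set.Icc s (s + α) := ⟨by linarith, le_rfl⟩
  have hB0 : 0 ≤ B := (norm_nonneg _).trans (hB s ⟨hs, by linarith⟩)
  have h1 : ∀ u ∈ Set.Icc s (s + α), ‖φ u - φ s‖ ≤ B * α := by
    intro u hu
    have := (convex_Icc s (s + α)).norm_image_sub_le_of_norm_hasDerivWithin_le hd
      (fun w hw => hB w ⟨hsub hw, hw.2.trans hsα⟩) hsmem hu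
    refine this.trans (mul_le_mul_of_nonneg_left ?_ hB0)
    rw [Real.norm_eq_abs, abs_of_nonneg (by linarith [hu.1])]
    linarith [hu.2]
  -- With the tangent line at s removed, the derivative is h(φ u) - h(φ s), of size at most L·B·α;
  -- the mean value inequality supplies the second factor α.
  have hd2 : ∀ u ∈ Set.Icc s (s + α), HasDerivWithinAt (fun u => φ u - u • h (φ s))
      (h (φ u) - (1 : ℝ) • h (φ s)) (Set.Icc s (s + α)) u := fun u hu =>
    (hd u hu).sub ((hasDerivWithinAt_id u _).smul_const (h (φ s)))
  have h2 := (convex_Icc s (s + α)).norm_image_sub_le_of_norm_hasDerivWithin_le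
    (C := L * (B * α)) hd2 (fun u hu => by
      rw [one_smul]
      exact (hL.norm_sub_le _ _).trans (mul_le_mul_of_nonneg_left (h1 u hu) L.2)) hsmem hemem
  have e1 : φ (s + α) - (s + α) • h (φ s) - (φ s - s • h (φ s))
      = φ (s + α) - φ s - α • h (φ s) := by
    rw [add_smul]; abel
  rw [e1, add_sub_cancel_left, Real.norm_eq_abs, abs_of_nonneg hα] at h2
  exact h2.trans_eq (by ring)

end ODE

lemma sub_eq_sum_Ico {E : Type*} [AddCommGroup E] (u : ℕ → E) {n j : ℕ} (hnj : n ≤ j) :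
    u j - u n = ∑ i ∈ Finset.Ico n j, (u (i + 1) - u i) := by
  induction j, hnj using Nat.le_induction with
  | base => simp
  | succ j hj ih => rw [Finset.sum_Ico_succ_top hj, ← ih]; abel

/-! ### Shadowing of ODE solutions over a finite horizon. -/

section Tracking

variable {E : Type*} [NormedAddCommGroup E] [NormedSpace ℝ E]

/-- The Euler scheme with step sizes `a` and with noise `e` whose localised weighted sums converge
stays close, over a finite horizon, to a solution of `x' = h(x)` it starts close to. -/
theorem euler_scheme_tracks_solution {h : E → E} {L : ℝ≥0} (hL : LipschitzWith L h) {a : ℕ → ℝ}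
    (ha : ∀ n, 0 < a n) (ha_sq : Summable fun n => a n ^ 2) {x e : ℕ → E}
    (hx : ∀ n, x (n + 1) = x n + a n • (h (x n) + e n))
    (hS : ∀ R : ℕ, CauchySeq fun n => ∑ i ∈ Finset.range n, (a i * cutoff R (x i)) • e i)
    {φ : ℝ → E} (hφ : ∀ t, 0 ≤ t → HasDerivWithinAt φ (h (φ t)) (Set.Ici 0) t)
    (T : ℝ) {η : ℝ} (hη : 0 < η) :
    ∃ ρ > 0, ∃ N, ∀ n ≥ N, ‖x n - φ 0‖ < ρ → ∀ j ≥ n, ∑ i ∈ Finset.Ico n j, a i ≤ T →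
      ‖x j - φ (∑ i ∈ Finset.Ico n j, a i)‖ ≤ η := by
  have hφc : ContinuousOn φ (Set.Icc 0 T) := fun t ht =>
    ((hφ t ht.1).continuousWithinAt).mono fun u hu => hu.1
  obtain ⟨R₀, hR₀⟩ := (isCompact_Icc (a := (0 : ℝ)) (b := T)).exists_bound_of_continuousOn hφc
  obtain ⟨B, hB⟩ := (isCompact_Icc (a := (0 : ℝ)) (b := T)).exists_bound_of_continuousOn
    (hL.continuous.comp_continuousOn hφc)
  -- A path within η' ≤ 1 of the solution stays in the ball of radius R, where the cut-off equals 1.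
  obtain ⟨R, hR⟩ := exists_nat_ge (R₀ + 1)
  set η' := min η 1 with hη'
  have hη'0 : 0 < η' := lt_min hη one_pos
  -- Three errors (initial distance, noise, discretisation) get κ each; Gronwall amplifies their sum
  -- by at most exp(L·T).
  set κ := η' * Real.exp (-(L * T)) / 3 with hκ
  have hκ0 : 0 < κ := by positivity
  obtain ⟨N₁, hN₁⟩ := Metric.cauchySeq_iff.1 (hS R) κ hκ0
  have hsqC : CauchySeq fun n => ∑ i ∈ Finset.range n, a i ^ 2 :=
    ha_sq.hasSum.tendsto_sum_nat.cauchySeq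
  obtain ⟨N₂, hN₂⟩ := Metric.cauchySeq_iff.1 hsqC (κ / (L * |B| + 1)) (by positivity)
  refine ⟨κ, hκ0, max N₁ N₂, fun n hn hxn => ?_⟩
  set s : ℕ → ℝ := fun j => ∑ i ∈ Finset.Ico n j, a i with hs
  have hs_nonneg : ∀ j, 0 ≤ s j := fun j => Finset.sum_nonneg fun i _ => (ha i).le
  have hs_succ : ∀ j ≥ n, s (j + 1) = s j + a j := fun j hj => Finset.sum_Ico_succ_top hj a
  have hs_mono : ∀ i j, n ≤ i → i ≤ j → s i ≤ s j := fun i j _ hij =>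
    Finset.sum_le_sum_of_subset_of_nonneg (Finset.Ico_subset_Ico le_rfl hij)
      fun k _ _ => (ha k).le
  have hexp : ∀ t ≤ T, 3 * κ * Real.exp (L * t) ≤ η' := by
    intro t ht
    have : 3 * κ * Real.exp (L * t) = η' * Real.exp (-(L * T) + L * t) := by
      rw [hκ, Real.exp_add]; ring
    rw [this]
    refine mul_le_of_le_one_right hη'0.le (Real.exp_le_one_iff.2 ?_)
    nlinarith [mul_le_mul_of_nonneg_left ht L.2]
  -- Discrete Gronwall. Strong induction is needed because the bound at all earlier indices both
  -- makes the cut-off 1 there and controls the drift sum.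
  have key : ∀ j, n ≤ j → s j ≤ T → ‖x j - φ (s j)‖ ≤ 3 * κ * Real.exp (L * s j) := by
    intro j
    induction j using Nat.strong_induction_on with
    | _ j ih =>
    intro hnj hsj
    have hsi : ∀ i ∈ Finset.Ico n j, s i + a i ≤ T := fun i hi => by
      rw [Finset.mem_Ico] at hi
      rw [← hs_succ i hi.1]
      exact (hs_mono (i + 1) j (by omega) hi.2).trans hsj
    have hsi' : ∀ i ∈ Finset.Ico n j, s i ≤ T := fun i hi => by linarith [hsi i hi, ha i]
    have hi : ∀ i ∈ Finset.Ico n j, ‖x i - φ (s i)‖ ≤ 3 * κ * Real.exp (L * s i) := fun i hi =>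
      ih i (Finset.mem_Ico.1 hi).2 (Finset.mem_Ico.1 hi).1 (hsi' i hi)
    have hcut : ∀ i ∈ Finset.Ico n j, cutoff (R : ℝ) (x i) = 1 := fun i hi' => by
      apply cutoff_eq_one
      have h1 := (hi i hi').trans ((hexp _ (hsi' i hi')).trans (min_le_right _ _))
      have h2 := hR₀ (s i) ⟨hs_nonneg i, hsi' i hi'⟩
      have h3 := norm_add_le (x i - φ (s i)) (φ (s i))
      rw [sub_add_cancel] at h3
      linarith
    have hdec : x j - φ (s j) = (x n - φ 0) + ∑ i ∈ Finset.Ico n j, a i • (h (x i) - h (φ (s i)))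
        + ∑ i ∈ Finset.Ico n j, (a i * cutoff (R : ℝ) (x i)) • e i
        - ∑ i ∈ Finset.Ico n j, (φ (s i + a i) - φ (s i) - a i • h (φ (s i))) := by
      have h0 : s n = 0 := by simp [hs]
      have h1 := sub_eq_sum_Ico (fun i => x i - φ (s i)) hnj
      rw [h0] at h1
      rw [add_assoc, add_sub_assoc, ← Finset.sum_add_distrib, ← Finset.sum_sub_distrib,
        ← sub_eq_iff_eq_add', h1]
      refine Finset.sum_congr rfl fun i hi' => ?_
      rw [hcut i hi', hx i, hs_succ i (Finset.mem_Ico.1 hi').1, mul_one, smul_add, smul_sub]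
      abel
    have b1 : ‖∑ i ∈ Finset.Ico n j, a i • (h (x i) - h (φ (s i)))‖
        ≤ 3 * κ * (Real.exp (L * s j) - 1) := by
      have h1 := sub_eq_sum_Ico (fun i => Real.exp (L * s i)) hnj
      have h0 : s n = 0 := by simp [hs]
      simp only [h0, mul_zero, Real.exp_zero] at h1
      rw [h1, Finset.mul_sum]
      refine norm_sum_le_of_le _ fun i hi' => ?_
      rw [norm_smul, Real.norm_eq_abs, abs_of_pos (ha i), hs_succ i (Finset.mem_Ico.1 hi').1]
      have h2 := (hL.norm_sub_le (x i) (φ (s i))).trans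
        (mul_le_mul_of_nonneg_left (hi i hi') L.2)
      -- This makes the drift sum telescope to 3κ(exp(L·s j) - 1); the missing 3κ is exactly the
      -- room for the three errors.
      have h3 : L * a i * Real.exp (L * s i)
          ≤ Real.exp (L * (s i + a i)) - Real.exp (L * s i) := by
        rw [mul_add, Real.exp_add]
        nlinarith [Real.add_one_le_exp (L * a i), Real.exp_pos (L * s i)]
      calc a i * ‖h (x i) - h (φ (s i))‖ ≤ a i * (L * (3 * κ * Real.exp (L * s i))) :=
            mul_le_mul_of_nonneg_left h2 (ha i).le
        _ = 3 * κ * (L * a i * Real.exp (L * s i)) := by ring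
        _ ≤ _ := mul_le_mul_of_nonneg_left h3 (by positivity)
    have b2 : ‖∑ i ∈ Finset.Ico n j, (a i * cutoff (R : ℝ) (x i)) • e i‖ ≤ κ := by
      rw [Finset.sum_Ico_eq_sub _ hnj, ← dist_eq_norm]
      exact (hN₁ j (((le_max_left _ _).trans hn).trans hnj) n ((le_max_left _ _).trans hn)).le
    have b3 : ‖∑ i ∈ Finset.Ico n j, (φ (s i + a i) - φ (s i) - a i • h (φ (s i)))‖ ≤ κ := by
      have h1 : ∑ i ∈ Finset.Ico n j, a i ^ 2 ≤ κ / (L * |B| + 1) := by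
        rw [Finset.sum_Ico_eq_sub _ hnj]
        exact (le_abs_self _).trans
          (hN₂ j (((le_max_right _ _).trans hn).trans hnj) n ((le_max_right _ _).trans hn)).le
      have h2 : ‖∑ i ∈ Finset.Ico n j, (φ (s i + a i) - φ (s i) - a i • h (φ (s i)))‖
          ≤ ∑ i ∈ Finset.Ico n j, (L * |B| + 1) * a i ^ 2 := by
        refine norm_sum_le_of_le _ fun i hi' => ?_
        refine (norm_euler_step_sub_le hL hφ hB (hs_nonneg i) (ha i).le (hsi i hi')).trans ?_
        refine mul_le_mul_of_nonneg_right ?_ (sq_nonneg _)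
        have := mul_le_mul_of_nonneg_left (le_abs_self B) L.2
        exact this.trans (lt_add_one _).le
      rw [← Finset.mul_sum] at h2
      refine h2.trans ?_
      rw [le_div_iff₀ (by positivity)] at h1
      linarith
    rw [hdec]
    refine (norm_sub_le _ _).trans ?_
    have n1 := norm_add_le ((x n - φ 0) + ∑ i ∈ Finset.Ico n j, a i • (h (x i) - h (φ (s i))))
      (∑ i ∈ Finset.Ico n j, (a i * cutoff (R : ℝ) (x i)) • e i)
    have n2 := norm_add_le (x n - φ 0) (∑ i ∈ Finset.Ico n j, a i • (h (x i) - h (φ (s i))))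
    linarith
  intro j hj hjT
  exact (key j hj hjT).trans ((hexp _ hjT).trans (min_le_left _ _))

end Tracking

/-! ### Transfer of hitting from solutions to the scheme. -/

section Hitting

variable {E : Type*} [NormedAddCommGroup E] [NormedSpace ℝ E]

/-- If a solution reaches the open set `U₁` while staying in the open set `U₂`, then so does the
Euler scheme whenever it passes, late enough, close enough to the initial point. -/
theorem euler_scheme_hits_open {h : E → E} {L : ℝ≥0} (hL : LipschitzWith L h) {a : ℕ → ℝ}
    (ha : ∀ n, 0 < a n) (ha_sum : Tendsto (fun n => ∑ i ∈ Finset.range n, a i) atTop atTop)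
    (ha_sq : Summable fun n => a n ^ 2) {x e : ℕ → E}
    (hx : ∀ n, x (n + 1) = x n + a n • (h (x n) + e n))
    (hS : ∀ R : ℕ, CauchySeq fun n => ∑ i ∈ Finset.range n, (a i * cutoff R (x i)) • e i)
    {φ : ℝ → E} (hφ : ∀ t, 0 ≤ t → HasDerivWithinAt φ (h (φ t)) (Set.Ici 0) t)
    {T : ℝ} (hT : 0 < T) {U₁ U₂ : Set E} (hU₁ : IsOpen U₁) (hU₂ : IsOpen U₂) (hφT : φ T ∈ U₁)
    (hφU₂ : ∀ t ∈ Set.Icc 0 T, φ t ∈ U₂) :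
    ∃ ρ > 0, ∃ N, ∀ n ≥ N, ‖x n - φ 0‖ < ρ →
      ∃ j > n, x j ∈ U₁ ∧ ∀ i, n ≤ i → i ≤ j → x i ∈ U₂ := by
  have hφc : ContinuousOn φ (Set.Icc 0 T) := fun t ht =>
    ((hφ t ht.1).continuousWithinAt).mono fun u hu => hu.1
  obtain ⟨η₁, hη₁, hth⟩ := (isCompact_Icc.image_of_continuousOn hφc).exists_cthickening_subset_open
    hU₂ (by rintro _ ⟨t, ht, rfl⟩; exact hφU₂ t ht)
  obtain ⟨η₂, hη₂, hball⟩ := Metric.isOpen_iff.1 hU₁ _ hφT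
  obtain ⟨δ, hδ, hδφ⟩ := Metric.continuousWithinAt_iff.1 (hφ T hT.le).continuousWithinAt
    (η₂ / 2) (half_pos hη₂)
  obtain ⟨ρ, hρ, N₁, hN₁⟩ := euler_scheme_tracks_solution hL ha ha_sq hx hS hφ T
    (lt_min hη₁ (by positivity : 0 < η₂ / 3))
  have ha0 : Tendsto a atTop (𝓝 0) := by
    have := ha_sq.tendsto_atTop_zero.sqrt
    simpa [Real.sqrt_sq (ha _).le] using this
  obtain ⟨N₂, hN₂⟩ := eventually_atTop.1 (ha0.eventually (gt_mem_nhds (lt_min hδ hT)))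
  refine ⟨ρ, hρ, max N₁ N₂, fun n hn hxn => ?_⟩
  have htrack := hN₁ n ((le_max_left _ _).trans hn) hxn
  set s : ℕ → ℝ := fun j => ∑ i ∈ Finset.Ico n j, a i with hs
  have hs_nonneg : ∀ j, 0 ≤ s j := fun j => Finset.sum_nonneg fun i _ => (ha i).le
  have hs_succ : ∀ j ≥ n, s (j + 1) = s j + a j := fun j hj => Finset.sum_Ico_succ_top hj a
  have hs_mono : ∀ i j, i ≤ j → s i ≤ s j := fun i j hij =>
    Finset.sum_le_sum_of_subset_of_nonneg (Finset.Ico_subset_Ico le_rfl hij)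
      fun k _ _ => (ha k).le
  have hex : ∃ m, n < m ∧ T < s m := by
    obtain ⟨m, hm⟩ := ((ha_sum.eventually_gt_atTop (T + ∑ i ∈ Finset.range n, a i)).and
      (eventually_gt_atTop n)).exists
    refine ⟨m, hm.2, ?_⟩
    simp only [hs]
    rw [Finset.sum_Ico_eq_sub _ hm.2.le]
    linarith [hm.1]
  -- The hitting index j is the predecessor of the first index past time T: then s j ≤ T < s j + a
  -- j, so s j is within δ of T. The requirement a j < T excludes j = n.
  obtain ⟨hnm, hTm⟩ := Nat.find_spec hex
  obtain ⟨j, hj⟩ : ∃ j, Nat.find hex = j + 1 := ⟨Nat.find hex - 1, by omega⟩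
  rw [hj] at hnm hTm
  have hnj : n ≤ j := by omega
  have haj : a j < min δ T := hN₂ j (((le_max_right _ _).trans hn).trans hnj)
  rw [hs_succ j hnj] at hTm
  have hjn : n < j := by
    rcases hnj.eq_or_lt with rfl | hlt
    · have : s n = 0 := by simp [hs]
      linarith [min_le_right δ T]
    · exact hlt
  have hsj : s j ≤ T := by
    by_contra hcon
    exact Nat.find_min hex (m := j) (by omega) ⟨hjn, not_le.1 hcon⟩
  refine ⟨j, hjn, hball ?_, fun i hni hij => hth ?_⟩
  · have h1 := (htrack j hnj hsj).trans (min_le_right _ _)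
    have h2 := hδφ (x := s j) (hs_nonneg j) (by
      rw [Real.dist_eq, abs_lt]
      constructor <;> linarith [min_le_left δ T])
    rw [← dist_eq_norm] at h1
    rw [Metric.mem_ball]
    have h3 := dist_triangle (x j) (φ (s j)) (φ T)
    linarith
  · have hsi := (hs_mono i j hij).trans hsj
    have h1 := (htrack i hni hsi).trans (min_le_left _ _)
    rw [← dist_eq_norm] at h1
    exact Metric.mem_cthickening_of_dist_le _ (φ (s i)) _ _ ⟨s i, ⟨hs_nonneg i, hsi⟩, rfl⟩ h1

end Hitting

/-- Compactness of H gives a uniform neighbourhood of H inside U. -/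
lemma ConvergesTo.eventually_mem {E : Type*} [PseudoEMetricSpace E] {φ : ℝ → E} {H U : Set E} (hφ : ConvergesTo φ atTop H)
    (hH : IsCompact H) (hU : IsOpen U) (hHU : H ⊆ U) : ∀ᶠ t in atTop, φ t ∈ U := by
  obtain ⟨r, hr, hrU⟩ := hH.exists_thickening_subset_open hU hHU
  filter_upwards [hφ.eventually (gt_mem_nhds (ENNReal.ofReal_pos.2 hr))] with t ht
  exact hrU ht

/-! ### Lyapunov stability and pathwise convergence. -/

section Lyapunov

variable {E : Type*} [NormedAddCommGroup E] [InnerProductSpace ℝ E] [CompleteSpace E]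

/-- A Lyapunov function is non-increasing along a solution that stays in `G`. -/
lemma IsStrictLyapunov.antitoneOn {h : E → E} {G H : Set E} {V : E → ℝ}
    (hV : IsStrictLyapunov h G V H) {φ : ℝ → E}
    (hφ : ∀ t, 0 ≤ t → HasDerivWithinAt φ (h (φ t)) (Set.Ici 0) t) {τ : ℝ}
    (hG : ∀ t ∈ Set.Icc 0 τ, φ t ∈ G) : AntitoneOn (fun t => V (φ t)) (Set.Icc 0 τ) := by
  have hd : ∀ t ∈ Set.Icc 0 τ, HasDerivWithinAt (fun t => V (φ t))
      (inner ℝ (gradient V (φ t)) (h (φ t))) (Set.Icc 0 τ) t := by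
    intro t ht
    have h1 := ((hV.differentiableOn.differentiableAt
      (hV.isOpen.mem_nhds (hG t ht))).hasGradientAt).hasFDerivAt
    have h2 := h1.comp_hasDerivWithinAt t ((hφ t ht.1).mono fun u (hu : u ∈ Set.Icc 0 τ) => hu.1)
    rw [InnerProductSpace.toDual_apply_apply] at h2
    exact h2
  refine antitoneOn_of_hasDerivWithinAt_nonpos (convex_Icc 0 τ)
    (fun t ht => (hd t ht).continuousWithinAt)
    (fun t ht => (hd t (interior_subset ht)).mono interior_subset)
    fun t ht => hV.nonpos _ (hG t (interior_subset ht))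

/-- Small sublevel sets of a Lyapunov function near `H` are forward invariant. -/
lemma IsStrictLyapunov.exists_invariant_sublevel [ProperSpace E] {h : E → E} {G H : Set E}
    {V : E → ℝ} (hV : IsStrictLyapunov h G V H) {δ : ℝ} (hδ : 0 < δ)
    (hδG : Metric.cthickening δ H ⊆ G) :
    ∃ c > 0, (∀ x ∈ Metric.cthickening δ H, V x < c → x ∈ Metric.thickening δ H) ∧
      ∀ φ : ℝ → E, (∀ t, 0 ≤ t → HasDerivWithinAt φ (h (φ t)) (Set.Ici 0) t) →
        φ 0 ∈ Metric.thickening δ H → V (φ 0) < c →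
        ∀ t, 0 ≤ t → φ t ∈ Metric.thickening δ H ∧ V (φ t) ≤ V (φ 0) := by
  have hHth : H ⊆ Metric.thickening δ H := Metric.self_subset_thickening hδ H
  have hScomp : IsCompact (Metric.cthickening δ H \ Metric.thickening δ H) :=
    hV.isCompact.cthickening.diff Metric.isOpen_thickening
  -- The shell between the open and the closed neighbourhood is compact and misses H, the zero set
  -- of V in G, so V is bounded below there by some c > 0. Crossing it would require V ≥ c.
  have hc : ∃ c > 0, ∀ x ∈ Metric.cthickening δ H \ Metric.thickening δ H, c ≤ V x := by
    rcases (Metric.cthickening δ H \ Metric.thickening δ H).eq_empty_or_nonempty with hS | hS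
    · exact ⟨1, one_pos, by simp [hS]⟩
    · obtain ⟨y, hy, hmin⟩ := hScomp.exists_isMinOn hS
        (hV.differentiableOn.continuousOn.mono fun z hz => hδG hz.1)
      refine ⟨V y, lt_of_le_of_ne (hV.nonneg y (hδG hy.1)) fun h0 => hy.2 (hHth ?_), hmin⟩
      rw [hV.eq_zeros]
      exact ⟨hδG hy.1, h0.symm⟩
  obtain ⟨c, hc0, hc⟩ := hc
  refine ⟨c, hc0, fun x hx hxc => ?_, fun φ hφ h0 h0c => ?_⟩
  · by_contra hcon
    exact (hc x ⟨hx, hcon⟩).not_gt hxc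
  have hφc : ContinuousOn φ (Set.Ici 0) := fun t ht => (hφ t ht).continuousWithinAt
  have hstay : ∀ t, 0 ≤ t → φ t ∈ Metric.thickening δ H := by
    by_contra hcon
    push Not at hcon
    obtain ⟨t₀, ht₀, ht₀'⟩ := hcon
    -- At the first exit time the solution lies on the shell, where V ≥ c, although V has only
    -- decreased from a value below c.
    set A := Set.Ici (0 : ℝ) ∩ φ ⁻¹' (Metric.thickening δ H)ᶜ with hA
    have hAcl : IsClosed A :=
      hφc.preimage_isClosed_of_isClosed isClosed_Ici Metric.isOpen_thickening.isClosed_compl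
    have hAbdd : BddBelow A := ⟨0, fun t ht => ht.1⟩
    have hτ : sInf A ∈ A := hAcl.csInf_mem ⟨t₀, ht₀, ht₀'⟩ hAbdd
    set τ := sInf A
    have hτ0 : 0 < τ := lt_of_le_of_ne hτ.1 fun h' => hτ.2 (h' ▸ h0)
    have hbefore : ∀ t ∈ Set.Ico 0 τ, φ t ∈ Metric.thickening δ H := fun t ht => by
      by_contra hcon
      exact (csInf_le hAbdd ⟨ht.1, hcon⟩).not_gt ht.2
    have hτcl : φ τ ∈ Metric.cthickening δ H := by
      have h1 : ContinuousWithinAt φ (Set.Ico 0 τ) τ :=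
        (hφc τ hτ0.le).mono fun u hu => hu.1
      have h2 : τ ∈ closure (Set.Ico 0 τ) := by
        rw [closure_Ico hτ0.ne]; exact ⟨hτ0.le, le_rfl⟩
      have := h1.mem_closure h2 (fun u hu => hbefore u hu)
      exact Metric.closure_thickening_subset_cthickening δ H this
    have hGτ : ∀ t ∈ Set.Icc 0 τ, φ t ∈ G := fun t ht => by
      rcases ht.2.eq_or_lt with rfl | hlt
      · exact hδG hτcl
      · exact hδG (Metric.thickening_subset_cthickening δ H (hbefore t ⟨ht.1, hlt⟩))
    have := hV.antitoneOn hφ hGτ (Set.left_mem_Icc.2 hτ0.le) (Set.right_mem_Icc.2 hτ0.le) hτ0.le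
    exact (hc _ ⟨hτcl, hτ.2⟩).not_gt (lt_of_le_of_lt this h0c)
  intro t ht
  refine ⟨hstay t ht, ?_⟩
  exact hV.antitoneOn hφ (τ := t) (fun u hu =>
    hδG (Metric.thickening_subset_cthickening δ H (hstay u hu.1)))
    (Set.left_mem_Icc.2 ht) (Set.right_mem_Icc.2 ht) ht

/-- The Euler scheme converges to the attractor `H` as soon as it visits infinitely often a compact
subset of its domain of attraction. -/
theorem euler_scheme_convergesTo [ProperSpace E] {h : E → E} {L : ℝ≥0} (hL : LipschitzWith L h)
    {a : ℕ → ℝ} (ha : ∀ n, 0 < a n)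
    (ha_sum : Tendsto (fun n => ∑ i ∈ Finset.range n, a i) atTop atTop)
    (ha_sq : Summable fun n => a n ^ 2) {x e : ℕ → E}
    (hx : ∀ n, x (n + 1) = x n + a n • (h (x n) + e n))
    (hS : ∀ R : ℕ, CauchySeq fun n => ∑ i ∈ Finset.range n, (a i * cutoff R (x i)) • e i)
    {G H : Set E} {V : E → ℝ} (hV : IsStrictLyapunov h G V H) (hG : G ⊆ domainOfAttraction h H)
    {K : Set E} (hK : IsCompact K) (hKG : K ⊆ G) (hfreq : ∃ᶠ n in atTop, x n ∈ K) :
    ConvergesTo x atTop H := by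
  have hHG : H ⊆ G := by rw [hV.eq_zeros]; exact fun z hz => hz.1
  obtain ⟨δ₀, hδ₀, hδ₀G⟩ := hV.isCompact.exists_cthickening_subset_open hV.isOpen hHG
  refine ENNReal.tendsto_nhds_zero.2 fun ε hε => ?_
  obtain ⟨δ₁, hδ₁, hδ₁ε⟩ : ∃ δ₁ : ℝ, 0 < δ₁ ∧ ENNReal.ofReal δ₁ ≤ ε := by
    obtain ⟨r, hr0, hrε⟩ := ENNReal.lt_iff_exists_nnreal_btwn.1 hε
    exact ⟨r, by exact_mod_cast hr0, by simpa using hrε.le⟩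
  set δ := min δ₀ δ₁
  have hδ : 0 < δ := lt_min hδ₀ hδ₁
  have hδG : Metric.cthickening δ H ⊆ G :=
    (Metric.cthickening_mono (min_le_left _ _) H).trans hδ₀G
  have hthG : Metric.thickening δ H ⊆ G :=
    (Metric.thickening_subset_cthickening δ H).trans hδG
  obtain ⟨c, hc0, hcth, hinv⟩ := hV.exists_invariant_sublevel hδ hδG
  have hUo : ∀ r, IsOpen (Metric.thickening δ H ∩ V ⁻¹' Set.Iio r) := fun r =>
    (hV.differentiableOn.continuousOn.mono hthG).isOpen_inter_preimage
      Metric.isOpen_thickening isOpen_Iio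
  have hHU : ∀ r > 0, H ⊆ Metric.thickening δ H ∩ V ⁻¹' Set.Iio r := fun r hr z hz => by
    refine ⟨Metric.self_subset_thickening hδ H hz, ?_⟩
    have : V z = 0 := by rw [hV.eq_zeros] at hz; exact hz.2
    simpa [this] using hr
  -- The gap between the levels c/3 and 2c/3 lets a solution with initial value V ≤ c/3 stay inside
  -- the open set `U₂`.
  set U₁ := Metric.thickening δ H ∩ V ⁻¹' Set.Iio (c / 3)
  set U₂ := Metric.thickening δ H ∩ V ⁻¹' Set.Iio (2 * c / 3)
  have hsol : ∀ z ∈ G, ∃ φ : ℝ → E, φ 0 = z ∧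
      (∀ t, 0 ≤ t → HasDerivWithinAt φ (h (φ t)) (Set.Ici 0) t) ∧ ∃ T > 0, φ T ∈ U₁ := by
    intro z hz
    obtain ⟨φ, h0, hφ, hconv⟩ := hG hz
    obtain ⟨T, hT⟩ := ((hconv.eventually_mem hV.isCompact (hUo _) (hHU (c / 3) (by positivity))).and
      (eventually_gt_atTop 0)).exists
    exact ⟨φ, h0, hφ, T, hT.2, hT.1⟩
  have hvisit : ∀ N, ∃ n ≥ N, x n ∈ U₁ := by
    intro N
    obtain ⟨z, hz, ψ, hψ, hlim⟩ := hK.tendsto_subseq' hfreq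
    obtain ⟨φ, h0, hφ, T, hT, hφT⟩ := hsol z (hKG hz)
    obtain ⟨ρ, hρ, N', hN'⟩ := euler_scheme_hits_open hL ha ha_sum ha_sq hx hS hφ hT
      (hUo _) isOpen_univ hφT (fun _ _ => Set.mem_univ _)
    obtain ⟨k, hk1, hk2⟩ := ((Metric.tendsto_nhds.1 hlim ρ hρ).and
      (hψ.tendsto_atTop.eventually_ge_atTop (max N N'))).exists
    obtain ⟨j, hj, hjU, -⟩ := hN' (ψ k) ((le_max_right _ _).trans hk2)
      (by rw [h0, ← dist_eq_norm]; exact hk1)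
    exact ⟨j, ((le_max_left _ _).trans hk2).trans hj.le, hjU⟩
  have hev : ∀ᶠ n in atTop, x n ∈ U₂ := by
    by_contra hcon
    rw [not_eventually] at hcon
    -- If `U₂` is left infinitely often, then so is `U₁` for the last time before such an exit: k is
    -- the last visit to `U₁` up to time m.
    have hbad : ∃ᶠ k in atTop, x k ∈ U₁ ∧ ∃ m > k, x m ∉ U₂ ∧
        ∀ j, k < j → j ≤ m → x j ∉ U₁ := by
      rw [frequently_atTop]
      intro N
      obtain ⟨n, hnN, hn⟩ := hvisit N
      obtain ⟨m, hmn, hm⟩ := frequently_atTop.1 hcon n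
      have hsub : U₁ ⊆ U₂ := fun z hz => 
        ⟨hz.1, (Set.mem_Iio.1 hz.2).trans_le (by linarith : c / 3 ≤ 2 * c / 3)⟩
      classical
      set k := Nat.findGreatest (fun k => x k ∈ U₁) m with hk
      have hkU : x k ∈ U₁ := Nat.findGreatest_spec (P := fun k => x k ∈ U₁) hmn hn
      have hnk : n ≤ k := Nat.le_findGreatest hmn hn
      have hkm : k ≤ m := Nat.findGreatest_le m
      refine ⟨k, hnN.trans hnk, hkU, m, lt_of_le_of_ne hkm fun h' => hm (hsub (h' ▸ hkU)), hm,
        fun j hkj hjm => Nat.findGreatest_is_greatest hkj hjm⟩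
    obtain ⟨ψ, hψ, hbadψ⟩ := extraction_of_frequently_atTop hbad
    obtain ⟨z, hz, ψ', hψ', hlim⟩ := (hV.isCompact.cthickening (r := δ)).tendsto_subseq
      (x := x ∘ ψ) fun n => Metric.thickening_subset_cthickening δ H (hbadψ n).1.1
    have hVz : V z ≤ c / 3 := by
      have h1 : Tendsto V (𝓝 z) (𝓝 (V z)) :=
        (hV.differentiableOn.differentiableAt (hV.isOpen.mem_nhds (hδG hz))).continuousAt
      exact le_of_tendsto (h1.comp hlim) (Eventually.of_forall fun n => (hbadψ (ψ' n)).1.2.le)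
    obtain ⟨φ, h0, hφ, T, hT, hφT⟩ := hsol z (hδG hz)
    have hφU₂ : ∀ t ∈ Set.Icc 0 T, φ t ∈ U₂ := fun t ht => by
      -- The limit point z is a priori only in the closed neighbourhood; V z ≤ c/3 < c puts it in
      -- the open one.
      obtain ⟨h1, h2⟩ := hinv φ hφ (h0 ▸ hcth z hz (by linarith)) (by rw [h0]; linarith) t ht.1
      rw [h0] at h2
      exact ⟨h1, by simp only [Set.mem_preimage, Set.mem_Iio]; linarith⟩
    obtain ⟨ρ, hρ, N', hN'⟩ := euler_scheme_hits_open hL ha ha_sum ha_sq hx hS hφ hT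
      (hUo _) (hUo _) hφT hφU₂
    obtain ⟨k, hk1, hk2⟩ := ((Metric.tendsto_nhds.1 hlim ρ hρ).and
      ((hψ.comp hψ').tendsto_atTop.eventually_ge_atTop N')).exists
    obtain ⟨j, hj, hjU, hji⟩ := hN' (ψ (ψ' k)) hk2 (by rw [h0, ← dist_eq_norm]; exact hk1)
    obtain ⟨-, m, hm, hmU, hmj⟩ := hbadψ (ψ' k)
    rcases le_total m j with hmj' | hjm
    · exact hmU (hji m hm.le hmj')
    · exact hmj j hj hjm hjU
  filter_upwards [hev] with n hn
  have h1 : Metric.infEDist (x n) H < ENNReal.ofReal δ := hn.1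
  exact h1.le.trans ((ENNReal.ofReal_le_ofReal (min_le_right _ _)).trans hδ₁ε)

end Lyapunov

/-! ### Conditional expectations through a transition kernel. -/

section ConditionalKernel

variable {Ω α S F : Type*} [MeasurableSpace α] [MeasurableSpace S] [NormedAddCommGroup F]
  [NormedSpace ℝ F] [CompleteSpace F]

/-- If `κ (X ·)` is a conditional law of `Z` given `m`, and `X` is `m`-measurable, then on an event
of `m` the joint law of `(X, Z)` disintegrates along `κ`. -/
lemma map_prodMk_restrict_eq_compProd {m m₀ : MeasurableSpace Ω} (hm : m ≤ m₀) {P : Measure Ω}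
    [IsProbabilityMeasure P] {X : Ω → α} (hX : Measurable[m] X) {Z : Ω → S} (hZ : Measurable Z)
    {κ : Kernel α S} [IsMarkovKernel κ]
    (hκ : ∀ C, MeasurableSet C →
      P[(Z ⁻¹' C).indicator (fun _ => (1 : ℝ)) | m] =ᵐ[P] fun ω => (κ (X ω)).real C)
    {A : Set Ω} (hA : MeasurableSet[m] A) :
    (P.restrict A).map (fun ω => (X ω, Z ω)) = (P.restrict A).map X ⊗ₘ κ := by
  have hX' : Measurable X := hX.mono hm le_rfl
  refine Measure.ext_prod fun {B C} hB hC => ?_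
  rw [Measure.map_apply (hX'.prodMk hZ) (hB.prod hC), Measure.compProd_apply_prod hB hC,
    setLIntegral_map hB (κ.measurable_coe hC) hX', Measure.restrict_restrict (hX' hB),
    Measure.restrict_apply (hX'.prodMk hZ (hB.prod hC))]
  have hXA : MeasurableSet[m] (X ⁻¹' B ∩ A) := (hX hB).inter hA
  have h1 : ∫ ω in X ⁻¹' B ∩ A, (κ (X ω)).real C ∂P
      = ∫ ω in X ⁻¹' B ∩ A, (Z ⁻¹' C).indicator (fun _ => (1 : ℝ)) ω ∂P := by
    rw [← setIntegral_condExp hm ((integrable_const (1 : ℝ)).indicator (hZ hC)) hXA]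
    exact setIntegral_congr_ae (hm _ hXA) ((hκ C hC).mono fun ω hω _ => hω.symm)
  rw [integral_indicator_const _ (hZ hC), smul_eq_mul, mul_one,
    measureReal_restrict_apply (hZ hC)] at h1
  have h2 : ∫⁻ ω in X ⁻¹' B ∩ A, κ (X ω) C ∂P
      = ENNReal.ofReal (∫ ω in X ⁻¹' B ∩ A, (κ (X ω)).real C ∂P) := by
    simp_rw [measureReal_def]
    rw [integral_toReal (show Measurable fun ω => κ (X ω) C from (κ.measurable_coe hC).comp hX').aemeasurable
      (Eventually.of_forall fun ω => measure_lt_top _ _), ENNReal.ofReal_toReal]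
    refine ne_of_lt (lt_of_le_of_lt (lintegral_mono fun ω => prob_le_one) ?_)
    simp
  change _ = ∫⁻ ω in X ⁻¹' B ∩ A, κ (X ω) C ∂P
  rw [h2, h1, ofReal_measureReal]
  congr 1
  ext ω
  simp only [Set.mem_inter_iff, Set.mem_preimage, Set.mem_prod]
  tauto

/-- The conditional expectation of `g (X, Z)` is computed by integrating `g (X, ·)` against a
conditional law of `Z`. -/
theorem condExp_comp_eq_integral_kernel {m m₀ : MeasurableSpace Ω} (hm : m ≤ m₀) {P : Measure Ω}
    [IsProbabilityMeasure P] {X : Ω → α} (hX : Measurable[m] X) {Z : Ω → S} (hZ : Measurable Z)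
    {κ : Kernel α S} [IsMarkovKernel κ]
    (hκ : ∀ C, MeasurableSet C →
      P[(Z ⁻¹' C).indicator (fun _ => (1 : ℝ)) | m] =ᵐ[P] fun ω => (κ (X ω)).real C)
    {g : α × S → F} (hg : StronglyMeasurable g) (hint : Integrable (fun ω => g (X ω, Z ω)) P) :
    P[fun ω => g (X ω, Z ω) | m] =ᵐ[P] fun ω => ∫ z, g (X ω, z) ∂κ (X ω) := by
  have hX' : Measurable X := hX.mono hm le_rfl
  have hgm : StronglyMeasurable fun x => ∫ z, g (x, z) ∂κ x := hg.integral_kernel_prod_right'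
  have hmap : ∀ A, MeasurableSet[m] A → Integrable g ((P.restrict A).map X ⊗ₘ κ) := fun A hA => by
    rw [← map_prodMk_restrict_eq_compProd hm hX hZ hκ hA,
      integrable_map_measure hg.aestronglyMeasurable (hX'.prodMk hZ).aemeasurable]
    exact hint.integrableOn
  refine (ae_eq_condExp_of_forall_setIntegral_eq hm hint (fun A hA _ => ?_) (fun A hA _ => ?_)
    ?_).symm
  · have : Integrable (fun x => ∫ z, g (x, z) ∂κ x) ((P.restrict A).map X) := by
      simpa using Integrable.integral_compProd (a := ()) (hmap A hA)
    rwa [integrable_map_measure hgm.aestronglyMeasurable hX'.aemeasurable] at this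
  · have h1 := Measure.integral_compProd (hmap A hA)
    rw [← map_prodMk_restrict_eq_compProd hm hX hZ hκ hA,
      integral_map (hX'.prodMk hZ).aemeasurable hg.aestronglyMeasurable,
      integral_map hX'.aemeasurable hgm.aestronglyMeasurable] at h1
    exact h1.symm
  · exact (hgm.comp_measurable hX).aestronglyMeasurable

end ConditionalKernel

/-! ### Convergence of square-integrable martingales. -/

section MartingaleDifferences

variable {Ω : Type*} {m₀ : MeasurableSpace Ω} {P : Measure Ω} [IsProbabilityMeasure P]
  {ℱ : Filtration ℕ m₀}

/-- The partial sums of a real martingale difference sequence with summable second moments converge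
almost surely. -/
theorem ae_exists_tendsto_sum_of_summable_sq {ξ : ℕ → Ω → ℝ}
    (hmeas : ∀ n, StronglyMeasurable[ℱ (n + 1)] (ξ n)) (hL2 : ∀ n, MemLp (ξ n) 2 P)
    (h0 : ∀ n, P[ξ n | ℱ n] =ᵐ[P] 0) {b : ℕ → ℝ} (hb : Summable b)
    (hξb : ∀ n, ∫ ω, ξ n ω ^ 2 ∂P ≤ b n) :
    ∀ᵐ ω ∂P, ∃ c, Tendsto (fun n => ∑ i ∈ Finset.range n, ξ i ω) atTop (𝓝 c) := by
  set S : ℕ → Ω → ℝ := fun n => ∑ i ∈ Finset.range n, ξ i with hS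
  have hSapp : ∀ n ω, S n ω = ∑ i ∈ Finset.range n, ξ i ω := fun n ω => by simp [hS]
  have hSsucc : ∀ n, S (n + 1) = S n + ξ n := fun n => by simp [hS, Finset.sum_range_succ]
  have hadp : StronglyAdapted ℱ S := fun n =>
    Finset.stronglyMeasurable_sum _ fun i hi =>
      (hmeas i).mono (ℱ.mono (Finset.mem_range.1 hi))
  have hSL2 : ∀ n, MemLp (S n) 2 P := fun n => memLp_finsetSum' _ fun i _ => hL2 i
  have hSint : ∀ n, Integrable (S n) P := fun n => (hSL2 n).integrable (by norm_num)
  have hξint : ∀ n, Integrable (ξ n) P := fun n => (hL2 n).integrable (by norm_num)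
  have hmart : Martingale S ℱ P := by
    refine martingale_of_condExp_sub_eq_zero_nat hadp hSint fun n => ?_
    rw [hSsucc, add_sub_cancel_left]
    exact h0 n
  have hcross : ∀ n, ∫ ω, S n ω * ξ n ω ∂P = 0 := by
    intro n
    have hprod : Integrable (S n * ξ n) P := (hSL2 n).integrable_mul (hL2 n)
    have h1 := condExp_mul_of_stronglyMeasurable_left (hadp n) hprod (hξint n)
    have h2 := integral_condExp (μ := P) (f := S n * ξ n) (ℱ.le n)
    rw [integral_congr_ae h1] at h2
    rw [← show ∫ ω, (S n * ξ n) ω ∂P = ∫ ω, S n ω * ξ n ω ∂P from rfl, ← h2]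
    refine integral_eq_zero_of_ae ?_
    filter_upwards [h0 n] with ω hω
    simp [hω]
  have hsq : ∀ n, ∫ ω, S n ω ^ 2 ∂P ≤ ∑ i ∈ Finset.range n, b i := by
    intro n
    induction n with
    | zero => simp [hS]
    | succ n ih =>
      have : ∀ ω, S (n + 1) ω ^ 2 = S n ω ^ 2 + 2 * (S n ω * ξ n ω) + ξ n ω ^ 2 := fun ω => by
        rw [hSsucc, Pi.add_apply]; ring
      simp_rw [this]
      have i1 : Integrable (fun ω => S n ω ^ 2) P := (hSL2 n).integrable_sq
      have i2 : Integrable (fun ω => 2 * (S n ω * ξ n ω)) P :=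
        ((hSL2 n).integrable_mul (hL2 n)).const_mul 2
      have i3 : Integrable (fun ω => ξ n ω ^ 2) P := (hL2 n).integrable_sq
      rw [integral_add (show Integrable (fun ω => S n ω ^ 2 + 2 * (S n ω * ξ n ω)) P from i1.add i2) i3, integral_add i1 i2, integral_const_mul, hcross,
        Finset.sum_range_succ]
      linarith [hξb n]
  have hb0 : ∀ n, 0 ≤ b n := fun n => (integral_nonneg fun ω => sq_nonneg _).trans (hξb n)
  have hbdd : ∀ n, eLpNorm (S n) 1 P ≤ ((1 + ∑' i, b i).toNNReal : ℝ≥0) := by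
    intro n
    rw [eLpNorm_one_eq_lintegral_enorm, ← ofReal_integral_norm_eq_lintegral_enorm (hSint n)]
    refine ENNReal.ofReal_le_ofReal ?_
    have h1 : ∫ ω, ‖S n ω‖ ∂P ≤ ∫ ω, (1 + S n ω ^ 2) ∂P := by
      refine integral_mono (hSint n).norm ((integrable_const _).add (hSL2 n).integrable_sq)
        fun ω => ?_
      simp only [Real.norm_eq_abs]
      nlinarith [sq_abs (S n ω), sq_nonneg (|S n ω| - 1)]
    rw [integral_add (integrable_const _) (hSL2 n).integrable_sq] at h1
    have h2 := (hsq n).trans (hb.sum_le_tsum _ fun i _ => hb0 i)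
    simp only [integral_const, probReal_univ, smul_eq_mul, mul_one] at h1
    linarith
  filter_upwards [hmart.submartingale.exists_ae_tendsto_of_bdd hbdd] with ω hω
  simpa only [hSapp] using hω

/-- The partial sums of a vector-valued martingale difference sequence with summable second moments
converge almost surely. -/
theorem ae_cauchySeq_sum_of_summable_sq {d : ℕ} {ξ : ℕ → Ω → EuclideanSpace ℝ (Fin d)}
    (hmeas : ∀ n, StronglyMeasurable[ℱ (n + 1)] (ξ n)) (hL2 : ∀ n, MemLp (ξ n) 2 P)
    (h0 : ∀ n, P[ξ n | ℱ n] =ᵐ[P] 0) {b : ℕ → ℝ} (hb : Summable b)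
    (hξb : ∀ n, ∫ ω, ‖ξ n ω‖ ^ 2 ∂P ≤ b n) :
    ∀ᵐ ω ∂P, CauchySeq fun n => ∑ i ∈ Finset.range n, ξ i ω := by
  have hcoord : ∀ k : Fin d, ∀ᵐ ω ∂P, ∃ c,
      Tendsto (fun n => ∑ i ∈ Finset.range n, ξ i ω k) atTop (𝓝 c) := by
    intro k
    set π : EuclideanSpace ℝ (Fin d) →L[ℝ] ℝ := EuclideanSpace.proj k
    have hπ : ∀ n, MemLp (fun ω => ξ n ω k) 2 P := fun n => π.comp_memLp' (hL2 n)
    refine ae_exists_tendsto_sum_of_summable_sq (ℱ := ℱ) (ξ := fun n ω => ξ n ω k)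
      (fun n => π.continuous.comp_stronglyMeasurable (hmeas n)) hπ (fun n => ?_) hb (fun n => ?_)
    · have h1 := π.comp_condExp_comm (m := ℱ n) ((hL2 n).integrable (by norm_num))
      refine EventuallyEq.trans h1.symm ?_
      filter_upwards [h0 n] with ω hω
      simp [hω]
    · refine le_trans (integral_mono (hπ n).integrable_sq (hL2 n).norm.integrable_sq
        fun ω => ?_) (hξb n)
      have := PiLp.norm_apply_le (ξ n ω) k
      rw [Real.norm_eq_abs] at this
      exact sq_le_sq' (by linarith [neg_abs_le (ξ n ω k)]) ((le_abs_self _).trans this)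
  filter_upwards [ae_all_iff.2 hcoord] with ω hω
  choose c hc using hω
  have : Tendsto (fun n => ∑ i ∈ Finset.range n, ξ i ω) atTop (𝓝 (WithLp.toLp 2 c)) := by
    have h1 : Tendsto (fun n => WithLp.ofLp (∑ i ∈ Finset.range n, ξ i ω)) atTop (𝓝 c) := by
      refine tendsto_pi_nhds.2 fun k => ?_
      simpa using hc k
    exact ((PiLp.continuous_toLp 2 _).tendsto c).comp h1
  exact this.cauchySeq

end MartingaleDifferences

/-! ### Localisation of Lipschitz fields. -/

section CutoffField

variable {E F : Type*} [NormedAddCommGroup E] [NormedAddCommGroup F]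
  [NormedSpace ℝ F]

lemma norm_cutoff_smul_le {R C : ℝ} (hC : 0 ≤ C) {v : E → F}
    (hv : ∀ ϑ, ‖ϑ‖ ≤ R + 1 → ‖v ϑ‖ ≤ C) (ϑ : E) : ‖cutoff R ϑ • v ϑ‖ ≤ C := by
  rw [norm_smul, Real.norm_eq_abs, abs_of_nonneg (cutoff_nonneg R ϑ)]
  rcases le_total ‖ϑ‖ (R + 1) with h | h
  · exact (mul_le_of_le_one_left (norm_nonneg _) (cutoff_le_one R ϑ)).trans (hv ϑ h)
  · rw [cutoff_eq_zero h, zero_mul]; exact hC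

/-- Cutting off a locally Lipschitz field makes it globally Lipschitz. -/
lemma norm_cutoff_smul_sub_le {R C : ℝ} (hC : 0 ≤ C) {v : E → F}
    (hv : ∀ ϑ, ‖ϑ‖ ≤ R + 1 → ‖v ϑ‖ ≤ C)
    (hv' : ∀ ϑ ϑ', ‖ϑ‖ ≤ R + 1 → ‖ϑ'‖ ≤ R + 1 → ‖v ϑ - v ϑ'‖ ≤ C * ‖ϑ - ϑ'‖) (ϑ ϑ' : E) :
    ‖cutoff R ϑ • v ϑ - cutoff R ϑ' • v ϑ'‖ ≤ 2 * C * ‖ϑ - ϑ'‖ := by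
  -- Nothing is known about v at ϑ', but its cut-off vanishes there, so the Lipschitz bound of the
  -- cut-off itself suffices.
  have key : ∀ ϑ ϑ' : E, ‖ϑ‖ ≤ R + 1 → R + 1 ≤ ‖ϑ'‖ →
      ‖cutoff R ϑ • v ϑ - cutoff R ϑ' • v ϑ'‖ ≤ 2 * C * ‖ϑ - ϑ'‖ := by
    intro ϑ ϑ' h h'
    have h1 := abs_cutoff_sub_le R ϑ ϑ'
    have h2 := hv ϑ h
    rw [cutoff_eq_zero h', sub_zero] at h1
    rw [cutoff_eq_zero h', zero_smul, sub_zero, norm_smul, Real.norm_eq_abs]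
    have := mul_le_mul h1 h2 (norm_nonneg _) (norm_nonneg _)
    nlinarith [mul_nonneg hC (norm_nonneg (ϑ - ϑ'))]
  rcases le_total ‖ϑ‖ (R + 1) with h | h <;> rcases le_total ‖ϑ'‖ (R + 1) with h' | h'
  · have e1 : cutoff R ϑ • v ϑ - cutoff R ϑ' • v ϑ'
        = (cutoff R ϑ - cutoff R ϑ') • v ϑ + cutoff R ϑ' • (v ϑ - v ϑ') := by
      rw [sub_smul, smul_sub]; abel
    rw [e1]
    refine (norm_add_le _ _).trans ?_
    rw [norm_smul, norm_smul, Real.norm_eq_abs, Real.norm_eq_abs,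
      abs_of_nonneg (cutoff_nonneg R ϑ')]
    have b1 := mul_le_mul (abs_cutoff_sub_le R ϑ ϑ') (hv ϑ h) (norm_nonneg _) (norm_nonneg _)
    have b2 := (mul_le_of_le_one_left (norm_nonneg (v ϑ - v ϑ')) (cutoff_le_one R ϑ')).trans
      (hv' ϑ ϑ' h h')
    linarith
  · exact key ϑ ϑ' h h'
  · rw [norm_sub_rev, norm_sub_rev ϑ]; exact key ϑ' ϑ h' h
  · rw [cutoff_eq_zero h, cutoff_eq_zero h', zero_smul, zero_smul, sub_zero, norm_zero]
    positivity

end CutoffField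

/-! ### Summation by parts along the path. -/

section Telescoping

/-- Abel summation for `∑ aᵢ (W(xᵢ, yᵢ) - W(xᵢ, yᵢ₊₁))` along a slowly varying sequence `x`. -/
theorem cauchySeq_sum_smul_sub_shift {E S F : Type*} [NormedAddCommGroup E]
    [SeminormedAddCommGroup S] [NormedAddCommGroup F] [NormedSpace ℝ F] [CompleteSpace F]
    {a : ℕ → ℝ} (ha : ∀ n, 0 < a n) (ha_anti : Antitone a) (ha_sq : Summable fun n => a n ^ 2)
    {W : E → S → F} {C D r : ℝ} (hC : 0 ≤ C) (hD : 0 ≤ D) (hr : 0 ≤ r)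
    (hW : ∀ ϑ y, ‖W ϑ y‖ ≤ C * (1 + ‖y‖))
    (hW' : ∀ ϑ ϑ' y, ‖W ϑ y - W ϑ' y‖ ≤ D * ‖ϑ - ϑ'‖ * (1 + ‖y‖))
    (hW0 : ∀ ϑ y, r ≤ ‖ϑ‖ → W ϑ y = 0)
    {x : ℕ → E} {y : ℕ → S} {K : ℝ} (hK : 0 ≤ K)
    (hx : ∀ n, ‖x (n + 1) - x n‖ ≤ a n * (K * (1 + ‖x n‖)))
    {B : ℝ} (hy : ∀ n, ‖y n‖ ≤ B) :
    CauchySeq fun n => ∑ i ∈ Finset.range n, a i • (W (x i) (y i) - W (x i) (y (i + 1))) := by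
  have hB : 0 ≤ B := (norm_nonneg _).trans (hy 0)
  have ha0 : Tendsto a atTop (𝓝 0) := by
    have := ha_sq.tendsto_atTop_zero.sqrt
    simpa [Real.sqrt_sq (ha _).le] using this
  have hWB : ∀ i, ‖W (x i) (y i)‖ ≤ C * (1 + B) := fun i =>
    (hW _ _).trans (mul_le_mul_of_nonneg_left (by linarith [hy i]) hC)
  -- The summand is `h3` minus `h2` minus `h1`: variation of W in x, variation of the step sizes,
  -- and an exact telescope of aᵢ W(xᵢ, yᵢ).
  have h1 : CauchySeq fun n => ∑ i ∈ Finset.range n,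
      (a (i + 1) • W (x (i + 1)) (y (i + 1)) - a i • W (x i) (y i)) := by
    simp_rw [Finset.sum_range_sub fun i => a i • W (x i) (y i)]
    have : Tendsto (fun n => a n • W (x n) (y n)) atTop (𝓝 0) :=
      squeeze_zero_norm (a := fun n => a n * (C * (1 + B))) (fun n => by
        rw [norm_smul, Real.norm_eq_abs, abs_of_pos (ha n)]
        exact mul_le_mul_of_nonneg_left (hWB n) (ha n).le) (by simpa using ha0.mul_const _)
    exact (this.sub_const _).cauchySeq
  have h2 : Summable fun i => (a i - a (i + 1)) • W (x (i + 1)) (y (i + 1)) := by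
    have hs : Summable fun i => a i - a (i + 1) := by
      refine summable_of_sum_range_le (c := a 0) (fun n => sub_nonneg.2 (ha_anti n.le_succ))
        fun n => ?_
      rw [Finset.sum_range_sub' a]
      linarith [ha n]
    refine Summable.of_norm_bounded (hs.mul_right (C * (1 + B))) fun i => ?_
    rw [norm_smul, Real.norm_eq_abs, abs_of_nonneg (sub_nonneg.2 (ha_anti i.le_succ))]
    exact mul_le_mul_of_nonneg_left (hWB _) (sub_nonneg.2 (ha_anti i.le_succ))
  have h3 : Summable fun i => a i • (W (x (i + 1)) (y (i + 1)) - W (x i) (y (i + 1))) := by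
    refine Summable.of_norm_bounded_eventually_nat
      (g := fun i => a i ^ 2 * (D * (K * (2 + 2 * r)) * (1 + B))) (ha_sq.mul_right _) ?_
    have hsmall : ∀ᶠ i in atTop, a i * K < 1 / 2 := by
      have : Tendsto (fun i => a i * K) atTop (𝓝 0) := by simpa using ha0.mul_const K
      exact this.eventually (gt_mem_nhds (by norm_num))
    filter_upwards [hsmall] with i hi
    rw [norm_smul, Real.norm_eq_abs, abs_of_pos (ha i), sq, mul_assoc]
    refine mul_le_mul_of_nonneg_left ?_ (ha i).le
    -- Once aᵢK < 1/2, a step has length at most (1 + ‖xᵢ‖)/2. From ‖xᵢ‖ ≥ 1 + 2r it thus ends at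
    -- norm at least r, and W vanishes at both ends.
    rcases le_total ‖x i‖ (1 + 2 * r) with h | h
    · refine (hW' _ _ _).trans ?_
      have b1 : ‖x (i + 1) - x i‖ ≤ a i * (K * (2 + 2 * r)) := (hx i).trans
        (mul_le_mul_of_nonneg_left (mul_le_mul_of_nonneg_left (by linarith) hK) (ha i).le)
      calc D * ‖x (i + 1) - x i‖ * (1 + ‖y (i + 1)‖)
          ≤ D * (a i * (K * (2 + 2 * r))) * (1 + B) := by
            gcongr
            · have := (ha i).le
              positivity
            · exact hy _
        _ = _ := by ring
    · have b1 : r ≤ ‖x (i + 1)‖ := by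
        have c1 := norm_sub_norm_le (x i) (x (i + 1))
        rw [norm_sub_rev] at c1
        have c2 := hx i
        have c3 : a i * (K * (1 + ‖x i‖)) ≤ 1 / 2 * (1 + ‖x i‖) := by
          rw [← mul_assoc]
          exact mul_le_mul_of_nonneg_right hi.le (by positivity)
        linarith
      rw [hW0 _ _ b1, hW0 _ _ (by linarith), sub_zero, norm_zero]
      have := (ha i).le
      positivity
  obtain ⟨l, hl⟩ := cauchySeq_tendsto_of_complete h1
  refine Tendsto.cauchySeq (((h3.hasSum.tendsto_sum_nat.sub h2.hasSum.tendsto_sum_nat).sub hl).congr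
    fun n => ?_)
  rw [← Finset.sum_sub_distrib, ← Finset.sum_sub_distrib]
  refine Finset.sum_congr rfl fun i _ => ?_
  simp only [smul_sub, sub_smul]
  abel

end Telescoping

/-! ### Martingale part of the noise. -/

section MartingaleNoise

variable {d : ℕ} {Ω : Type*} {m₀ : MeasurableSpace Ω} {P : Measure Ω} [IsProbabilityMeasure P]
  {ℱ : Filtration ℕ m₀}

/-- The martingale part of the noise: a bounded martingale difference sequence plus the one-step
prediction errors of `W(θₙ, Yₙ₊₁)`, with square summable weights. -/
theorem ae_cauchySeq_sum_prediction_error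
    {θ Y N : ℕ → Ω → EuclideanSpace ℝ (Fin d)}
    (hθ : ∀ n, Measurable[ℱ n] (θ n)) (hY : ∀ n, Measurable[ℱ n] (Y n))
    {Q : Kernel (EuclideanSpace ℝ (Fin d) × EuclideanSpace ℝ (Fin d)) (EuclideanSpace ℝ (Fin d))}
    [IsMarkovKernel Q] (hQ : IsIterateDependentMarkov P ℱ Q θ Y)
    (hY_moment : limsup (fun n => ∫⁻ ω, ‖Y n ω‖ₑ ^ 2 ∂P) atTop < ∞)
    {a : ℕ → ℝ} (ha_sq : Summable fun n => a n ^ 2)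
    (hN : ∀ n, StronglyMeasurable[ℱ (n + 1)] (N n)) (hN0 : ∀ n, P[N n | ℱ n] =ᵐ[P] 0)
    {B : ℝ} (hNB : ∀ n, ∀ᵐ ω ∂P, ‖N n ω‖ ≤ B)
    {W q : EuclideanSpace ℝ (Fin d) → EuclideanSpace ℝ (Fin d) → EuclideanSpace ℝ (Fin d)}
    (hW : Measurable (Function.uncurry W)) {C : ℝ}
    (hWC : ∀ ϑ y, ‖W ϑ y‖ ≤ C * (1 + ‖y‖))
    (hq : ∀ ϑ y, q ϑ y = ∫ z, W ϑ z ∂Q (ϑ, y)) (hqC : ∀ ϑ y, ‖q ϑ y‖ ≤ C * (1 + ‖y‖)) :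
    ∀ᵐ ω ∂P, CauchySeq fun n => ∑ i ∈ Finset.range n,
      a i • (N i ω + (W (θ i ω) (Y (i + 1) ω) - q (θ i ω) (Y i ω))) := by
  -- Second moments of Y are controlled only from some n₀ on and may be infinite earlier; the
  -- finitely many earlier terms are zeroed and restored pathwise at the end.
  obtain ⟨b, hb1, hb2⟩ := exists_between hY_moment
  obtain ⟨n₀, hn₀⟩ := eventually_atTop.1 (eventually_lt_of_limsup_lt hb1)
  have hYm : ∀ n, Measurable (Y n) := fun n => (hY n).mono (ℱ.le n) le_rfl
  
  have hY2 : ∀ n ≥ n₀, MemLp (Y n) 2 P := fun n hn => by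
    refine ⟨(hYm n).aestronglyMeasurable, ?_⟩
    rw [eLpNorm_lt_top_iff_lintegral_rpow_enorm_lt_top (by norm_num) (by norm_num)]
    simpa using (hn₀ n hn).trans hb2
  have hY2b : ∀ n ≥ n₀, ∫ ω, ‖Y n ω‖ ^ 2 ∂P ≤ b.toReal := fun n hn => by
    rw [integral_eq_lintegral_of_nonneg_ae (Eventually.of_forall fun ω => sq_nonneg _)
      ((hYm n).norm.pow_const 2).aestronglyMeasurable]
    refine ENNReal.toReal_mono hb2.ne (le_trans (le_of_eq ?_) (hn₀ n hn).le)
    refine lintegral_congr fun ω => ?_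
    rw [ENNReal.ofReal_pow (norm_nonneg _), ofReal_norm]
  have hqm : StronglyMeasurable fun p : EuclideanSpace ℝ (Fin d) × EuclideanSpace ℝ (Fin d) =>
      q p.1 p.2 := by
    simp_rw [hq]
    have : StronglyMeasurable fun p : (EuclideanSpace ℝ (Fin d) × EuclideanSpace ℝ (Fin d)) ×
        EuclideanSpace ℝ (Fin d) => W p.1.1 p.2 :=
      (hW.comp ((measurable_fst.comp measurable_fst).prodMk measurable_snd)).stronglyMeasurable
    exact this.integral_kernel_prod_right'
  set ζ : ℕ → Ω → EuclideanSpace ℝ (Fin d) := fun i ω =>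
    a i • (N i ω + (W (θ i ω) (Y (i + 1) ω) - q (θ i ω) (Y i ω))) with hζ
  have hXm : ∀ i, Measurable[ℱ i] fun ω => (θ i ω, Y i ω) := fun i => (hθ i).prodMk (hY i)
  have hqmeas : ∀ i, StronglyMeasurable[ℱ i] fun ω => q (θ i ω) (Y i ω) := fun i =>
    hqm.comp_measurable (hXm i)
  have hWmeas : ∀ i, StronglyMeasurable[ℱ (i + 1)] fun ω => W (θ i ω) (Y (i + 1) ω) := fun i =>
    hW.stronglyMeasurable.comp_measurable
      (((hθ i).mono (ℱ.mono i.le_succ) le_rfl).prodMk (hY (i + 1)))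
  have hζmeas : ∀ i, StronglyMeasurable[ℱ (i + 1)] (ζ i) := fun i =>
    ((hN i).add ((hWmeas i).sub ((hqmeas i).mono (ℱ.mono i.le_succ)))).const_smul (a i)
  have hY1 : ∀ n ≥ n₀, MemLp (fun ω => C * (1 + ‖Y n ω‖)) 2 P := fun n hn =>
    MemLp.const_mul (f := fun ω => 1 + ‖Y n ω‖) (MemLp.add (f := fun _ => (1 : ℝ))
      (g := fun ω => ‖Y n ω‖) (memLp_const 1) (hY2 n hn).norm) C
  have hW2 : ∀ i ≥ n₀, MemLp (fun ω => W (θ i ω) (Y (i + 1) ω)) 2 P := fun i hi => by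
    refine MemLp.of_le (hY1 (i + 1) (by omega))
      ((hWmeas i).mono (ℱ.le _)).aestronglyMeasurable (Eventually.of_forall fun ω => ?_)
    exact (hWC _ _).trans (le_abs_self _)
  have hq2 : ∀ i ≥ n₀, MemLp (fun ω => q (θ i ω) (Y i ω)) 2 P := fun i hi => by
    refine MemLp.of_le (hY1 i hi)
      ((hqmeas i).mono (ℱ.le _)).aestronglyMeasurable (Eventually.of_forall fun ω => ?_)
    exact (hqC _ _).trans (le_abs_self _)
  have hN2 : ∀ i, MemLp (N i) 2 P := fun i =>
    MemLp.of_bound ((hN i).mono (ℱ.le _)).aestronglyMeasurable B (hNB i)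
  have hζ2 : ∀ i ≥ n₀, MemLp (ζ i) 2 P := fun i hi =>
    ((hN2 i).add ((hW2 i hi).sub (hq2 i hi))).const_smul (a i)
  have hζ0 : ∀ i ≥ n₀, P[ζ i | ℱ i] =ᵐ[P] 0 := fun i hi => by
    have iN := (hN2 i).integrable (by norm_num : (1 : ℝ≥0∞) ≤ 2)
    have iW := (hW2 i hi).integrable (by norm_num : (1 : ℝ≥0∞) ≤ 2)
    have iq := (hq2 i hi).integrable (by norm_num : (1 : ℝ≥0∞) ≤ 2)
    have hg : StronglyMeasurable fun p : (EuclideanSpace ℝ (Fin d) × EuclideanSpace ℝ (Fin d)) ×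
        EuclideanSpace ℝ (Fin d) => W p.1.1 p.2 :=
      (hW.comp ((measurable_fst.comp measurable_fst).prodMk measurable_snd)).stronglyMeasurable
    have e1 := condExp_comp_eq_integral_kernel (ℱ.le i) (hXm i) (hYm (i + 1)) (hQ i) hg iW
    have e2 := condExp_smul (μ := P) (a i)
      (N i + ((fun ω => W (θ i ω) (Y (i + 1) ω)) - fun ω => q (θ i ω) (Y i ω))) (ℱ i)
    have e3 := condExp_add iN (iW.sub iq) (ℱ i)
    have e4 := condExp_sub iW iq (ℱ i)
    have e5 := condExp_of_stronglyMeasurable (ℱ.le i) (hqmeas i) iq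
    refine EventuallyEq.trans e2 ?_
    filter_upwards [e1, e3, e4, hN0 i] with ω h1 h3 h4 h0
    rw [Pi.smul_apply, h3, Pi.add_apply, h4, Pi.sub_apply, h0, e5, h1]
    simp [hq]
  have hbound : ∀ i ≥ n₀, ∫ ω, ‖ζ i ω‖ ^ 2 ∂P
      ≤ a i ^ 2 * (3 * ((B + 2 * C) ^ 2 + C ^ 2 * b.toReal + C ^ 2 * b.toReal)) := fun i hi => by
    have i1 := (hY2 i hi).norm.integrable_sq
    have i2 := (hY2 (i + 1) (by omega)).norm.integrable_sq
    have hle : ∫ ω, ‖ζ i ω‖ ^ 2 ∂P ≤ ∫ ω, a i ^ 2 * (3 * ((B + 2 * C) ^ 2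
        + C ^ 2 * ‖Y i ω‖ ^ 2 + C ^ 2 * ‖Y (i + 1) ω‖ ^ 2)) ∂P := by
      refine integral_mono_ae (hζ2 i hi).norm.integrable_sq
        ((((integrable_const _).add (i1.const_mul _)).add (i2.const_mul _)).const_mul 3
          |>.const_mul _) ?_
      filter_upwards [hNB i] with ω hω
      have h1 : ‖N i ω + (W (θ i ω) (Y (i + 1) ω) - q (θ i ω) (Y i ω))‖
          ≤ (B + 2 * C) + C * ‖Y i ω‖ + C * ‖Y (i + 1) ω‖ := by
        have n1 := norm_add_le (N i ω) (W (θ i ω) (Y (i + 1) ω) - q (θ i ω) (Y i ω))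
        have n2 := norm_sub_le (W (θ i ω) (Y (i + 1) ω)) (q (θ i ω) (Y i ω))
        linarith [hWC (θ i ω) (Y (i + 1) ω), hqC (θ i ω) (Y i ω)]
      simp only [hζ]
      rw [norm_smul, mul_pow, Real.norm_eq_abs, sq_abs]
      refine mul_le_mul_of_nonneg_left ?_ (sq_nonneg _)
      refine (pow_le_pow_left₀ (norm_nonneg _) h1 2).trans ?_
      nlinarith [sq_nonneg ((B + 2 * C) - C * ‖Y i ω‖), sq_nonneg ((B + 2 * C) - C * ‖Y (i + 1) ω‖),
        sq_nonneg (C * ‖Y i ω‖ - C * ‖Y (i + 1) ω‖)]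
    refine hle.trans ?_
    rw [integral_const_mul, integral_const_mul,
      integral_add (show Integrable (fun ω => (B + 2 * C) ^ 2 + C ^ 2 * ‖Y i ω‖ ^ 2) P from
        (integrable_const _).add (i1.const_mul _)) (i2.const_mul _),
      integral_add (integrable_const _) (i1.const_mul _), integral_const_mul, integral_const_mul,
      integral_const, probReal_univ, one_smul]
    have := hY2b i hi
    have := hY2b (i + 1) (by omega)
    gcongr
  have hmain := ae_cauchySeq_sum_of_summable_sq (P := P) (ℱ := ℱ)
    (ξ := fun i => if n₀ ≤ i then ζ i else 0)
    (b := fun i => a i ^ 2 * (3 * ((B + 2 * C) ^ 2 + C ^ 2 * b.toReal + C ^ 2 * b.toReal)))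
    (fun i => by split_ifs; exacts [hζmeas i, stronglyMeasurable_zero])
    (fun i => by split_ifs with hi; exacts [hζ2 i hi, MemLp.zero'])
    (fun i => by split_ifs with hi; exacts [hζ0 i hi, by rw [condExp_zero]])
    (ha_sq.mul_right _)
    (fun i => by
      split_ifs with hi
      · exact hbound i hi
      · simp only [Pi.zero_apply, norm_zero, ne_eq, OfNat.ofNat_ne_zero, not_false_eq_true,
          zero_pow, integral_zero]
        positivity)
  filter_upwards [hmain] with ω hω
  obtain ⟨l, hl⟩ := cauchySeq_tendsto_of_complete hω
  have hl' := hl.add_const (∑ i ∈ Finset.range n₀, ζ i ω)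
  refine Tendsto.cauchySeq (hl'.congr' ?_)
  filter_upwards [eventually_ge_atTop n₀] with n hn
  induction n, hn using Nat.le_induction with
  | base =>
    rw [Finset.sum_eq_zero fun i hi => ?_, zero_add]
    rw [if_neg (by simpa using hi), Pi.zero_apply]
  | succ n hn ih =>
    rw [Finset.sum_range_succ, Finset.sum_range_succ, if_pos hn, ← ih]
    abel

end MartingaleNoise

/-! ### The full localised noise. -/

section LocalisedNoise

variable {d : ℕ} {Ω : Type*} {m₀ : MeasurableSpace Ω} {P : Measure Ω} [IsProbabilityMeasure P]
  {ℱ : Filtration ℕ m₀}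

/-- The noise of the recursion, localised to a ball, has almost surely convergent weighted sums. -/
theorem ae_cauchySeq_sum_localised_noise
    {θ Y M : ℕ → Ω → EuclideanSpace ℝ (Fin d)}
    (hθ : ∀ n, Measurable[ℱ n] (θ n)) (hY : ∀ n, Measurable[ℱ n] (Y n))
    (hM : IsMartingaleDifference P ℱ M)
    {Q : Kernel (EuclideanSpace ℝ (Fin d) × EuclideanSpace ℝ (Fin d)) (EuclideanSpace ℝ (Fin d))}
    [IsMarkovKernel Q] (hQ : IsIterateDependentMarkov P ℱ Q θ Y)
    {f : EuclideanSpace ℝ (Fin d) → EuclideanSpace ℝ (Fin d) → EuclideanSpace ℝ (Fin d)}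
    {a : ℕ → ℝ}
    (hrec : ∀ n ω, θ (n + 1) ω = θ n ω + a n • (f (θ n ω) (Y n ω) + M (n + 1) ω))
    (hY_limsup : ∃ C : ℝ≥0, ∀ᵐ ω ∂P, limsup (fun n => ‖Y n ω‖ₑ) atTop < (C : ℝ≥0∞))
    (hY_moment : limsup (fun n => ∫⁻ ω, ‖Y n ω‖ₑ ^ 2 ∂P) atTop < ∞)
    (hf_growth : ∃ K : ℝ, ∀ ϑ y, ‖f ϑ y‖ ≤ K * (1 + ‖ϑ‖))
    (ha : ∀ n, 0 < a n) (ha_anti : Antitone a) (ha_sq : Summable fun n => a n ^ 2)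
    {h : EuclideanSpace ℝ (Fin d) → EuclideanSpace ℝ (Fin d)} {L : ℝ≥0} (hL : LipschitzWith L h)
    (hM_bound : ∃ K' : ℝ, ∀ n, ∀ᵐ ω ∂P, ‖M (n + 1) ω‖ ≤ K' * (1 + ‖θ n ω‖))
    {v : EuclideanSpace ℝ (Fin d) → EuclideanSpace ℝ (Fin d) → EuclideanSpace ℝ (Fin d)}
    (hv_poisson : ∀ ϑ, SolvesPoisson (Q.sectR ϑ) (fun y => f ϑ y - h ϑ) (v ϑ))
    (hv_bound : ∀ R : ℝ, 0 < R → ∃ C : ℝ, 0 < C ∧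
      (∀ ϑ x, ‖ϑ‖ ≤ R → ‖v ϑ x‖ ≤ C * (1 + ‖x‖)) ∧
      (∀ ϑ ϑ' x, ‖ϑ‖ ≤ R → ‖ϑ'‖ ≤ R → ‖v ϑ x - v ϑ' x‖ ≤ C * ‖ϑ - ϑ'‖ * (1 + ‖x‖)))
    {R : ℝ} (hR : 0 ≤ R) :
    ∀ᵐ ω ∂P, CauchySeq fun n => ∑ i ∈ Finset.range n,
      (a i * cutoff R (θ i ω)) • (f (θ i ω) (Y i ω) - h (θ i ω) + M (i + 1) ω) := by
  obtain ⟨C, hC, hvC, hvL⟩ := hv_bound (R + 1) (by linarith)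
  obtain ⟨K, hK⟩ := hf_growth
  obtain ⟨K', hK'⟩ := hM_bound
  obtain ⟨CY, hCY⟩ := hY_limsup
  set W : EuclideanSpace ℝ (Fin d) → EuclideanSpace ℝ (Fin d) → EuclideanSpace ℝ (Fin d) :=
    fun ϑ y => cutoff R ϑ • v ϑ y with hWdef
  -- By the Poisson equation this is the kernel average of W. In this form its linear growth is
  -- immediate from that of W and the boundedness of the localised f - h.
  set q : EuclideanSpace ℝ (Fin d) → EuclideanSpace ℝ (Fin d) → EuclideanSpace ℝ (Fin d) :=
    fun ϑ y => W ϑ y - cutoff R ϑ • (f ϑ y - h ϑ) with hqdef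
  set D := |K| * (1 + (R + 1)) + (‖h 0‖ + L * (R + 1)) with hD
  have hD0 : 0 ≤ D := by positivity
  have hWC : ∀ ϑ y, ‖W ϑ y‖ ≤ C * (1 + ‖y‖) := fun ϑ y =>
    norm_cutoff_smul_le (v := fun ϑ => v ϑ y) (by positivity) (fun ϑ hϑ => hvC ϑ y hϑ) ϑ
  have hWL : ∀ ϑ ϑ' y, ‖W ϑ y - W ϑ' y‖ ≤ 2 * C * ‖ϑ - ϑ'‖ * (1 + ‖y‖) := fun ϑ ϑ' y => by
    refine (norm_cutoff_smul_sub_le (C := C * (1 + ‖y‖)) (v := fun ϑ => v ϑ y) (by positivity)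
      (fun ϑ hϑ => hvC ϑ y hϑ) (fun ϑ ϑ' hϑ hϑ' => ?_) ϑ ϑ').trans_eq (by ring)
    exact (hvL ϑ ϑ' y hϑ hϑ').trans_eq (by ring)
  have hW0 : ∀ ϑ y, R + 1 ≤ ‖ϑ‖ → W ϑ y = 0 := fun ϑ y hϑ => by
    simp only [hWdef, cutoff_eq_zero hϑ, zero_smul]
  have hfh : ∀ ϑ y, ‖cutoff R ϑ • (f ϑ y - h ϑ)‖ ≤ D := fun ϑ y => by
    refine norm_cutoff_smul_le (v := fun ϑ => f ϑ y - h ϑ) hD0 (fun ϑ hϑ => ?_) ϑ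
    refine (norm_sub_le _ _).trans (add_le_add ?_ ?_)
    · refine (hK ϑ y).trans ?_
      gcongr
      exact le_abs_self K
    · have h1 := hL.norm_sub_le ϑ 0
      rw [sub_zero] at h1
      have h2 := norm_le_norm_add_norm_sub' (h ϑ) (h 0)
      have h3 : (L : ℝ) * ‖ϑ‖ ≤ L * (R + 1) := mul_le_mul_of_nonneg_left hϑ L.2
      linarith
  -- The solutions v are measurable only in y for each ϑ; joint measurability of W comes from its
  -- Lipschitz continuity in ϑ (a Carathéodory function).
  have hWm : Measurable (Function.uncurry W) := by
    refine measurable_uncurry_of_continuous_of_measurable (fun y => ?_)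
      fun ϑ => (hv_poisson ϑ).1.const_smul (cutoff R ϑ)
    refine (LipschitzWith.of_dist_le' (K := 2 * C * (1 + ‖y‖)) fun ϑ ϑ' => ?_).continuous
    rw [dist_eq_norm, dist_eq_norm]
    exact (hWL ϑ ϑ' y).trans_eq (by ring)
  have hq : ∀ ϑ y, q ϑ y = ∫ z, W ϑ z ∂Q (ϑ, y) := fun ϑ y => by
    have h1 := ((hv_poisson ϑ).2 y).2
    rw [Kernel.sectR_apply] at h1
    simp only [hqdef, hWdef]
    rw [integral_smul, show f ϑ y - h ϑ = _ from h1.symm, smul_sub]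
    abel
  have hqC : ∀ ϑ y, ‖q ϑ y‖ ≤ (C + D) * (1 + ‖y‖) := fun ϑ y => by
    have h1 := (norm_sub_le _ _).trans (add_le_add (hWC ϑ y) (hfh ϑ y))
    have h2 : D ≤ D * (1 + ‖y‖) := le_mul_of_one_le_right hD0 (by linarith [norm_nonneg y])
    simp only [hqdef]
    linarith
  have hcutm : ∀ i, StronglyMeasurable[ℱ i] fun ω => cutoff R (θ i ω) := fun i =>
    ((continuous_cutoff R).measurable.comp (hθ i)).stronglyMeasurable
  have hNm : ∀ i, StronglyMeasurable[ℱ (i + 1)] ((fun ω => cutoff R (θ i ω)) • M (i + 1)) :=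
    fun i => ((hcutm i).mono (ℱ.mono i.le_succ)).smul (hM i).1
  have hNB : ∀ i, ∀ᵐ ω ∂P, ‖((fun ω => cutoff R (θ i ω)) • M (i + 1)) ω‖
      ≤ |K'| * (1 + (R + 1)) := fun i => by
    filter_upwards [hK' i] with ω hω
    rw [Pi.smul_apply', norm_smul, Real.norm_eq_abs, abs_of_nonneg (cutoff_nonneg _ _)]
    rcases le_total ‖θ i ω‖ (R + 1) with hle | hle
    · refine (mul_le_of_le_one_left (norm_nonneg _) (cutoff_le_one _ _)).trans (hω.trans ?_)
      gcongr
      exact le_abs_self K'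
    · rw [cutoff_eq_zero hle, zero_mul]
      positivity
  have hN0 : ∀ i, P[(fun ω => cutoff R (θ i ω)) • M (i + 1) | ℱ i] =ᵐ[P] 0 := fun i => by
    have hint : Integrable ((fun ω => cutoff R (θ i ω)) • M (i + 1)) P :=
      Integrable.of_bound ((hNm i).mono (ℱ.le _)).aestronglyMeasurable _ (hNB i)
    refine (condExp_smul_of_aestronglyMeasurable_left (hcutm i).aestronglyMeasurable hint
      (hM i).2.1).trans ?_
    filter_upwards [(hM i).2.2] with ω hω
    rw [Pi.smul_apply', hω]
    simp
  have hmart := ae_cauchySeq_sum_prediction_error hθ hY hQ hY_moment ha_sq hNm hN0 hNB hWm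
    (C := C + D)
    (fun ϑ y => (hWC ϑ y).trans (by gcongr; linarith)) hq hqC
  filter_upwards [hmart, ae_all_iff.2 hK', hCY] with ω h1 h2 h3
  obtain ⟨B, hB⟩ : ∃ B, ∀ n, ‖Y n ω‖ ≤ B := by
    have h4 : IsBoundedUnder (· ≤ ·) atTop fun n => ‖Y n ω‖ := by
      refine ⟨CY, eventually_map.2 ?_⟩
      filter_upwards [eventually_lt_of_limsup_lt h3] with n hn
      have : ‖Y n ω‖₊ < CY := by exact_mod_cast hn
      exact_mod_cast this.le
    obtain ⟨B, hB⟩ := h4.bddAbove_range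
    exact ⟨B, fun n => hB ⟨n, rfl⟩⟩
  have hstep : ∀ n, ‖θ (n + 1) ω - θ n ω‖ ≤ a n * ((|K| + |K'|) * (1 + ‖θ n ω‖)) := fun n => by
    rw [hrec, add_sub_cancel_left, norm_smul, Real.norm_eq_abs, abs_of_pos (ha n), add_mul]
    refine mul_le_mul_of_nonneg_left ((norm_add_le _ _).trans (add_le_add ?_ ?_)) (ha n).le
    · exact (hK _ _).trans (by gcongr; exact le_abs_self K)
    · exact (h2 n).trans (by gcongr; exact le_abs_self K')
  have hKK : 0 ≤ |K| + |K'| := by positivity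
  have h2C : 0 ≤ 2 * C := by positivity
  have hR1 : 0 ≤ R + 1 := by positivity
  have htel := cauchySeq_sum_smul_sub_shift (W := W) (x := fun n => θ n ω) (y := fun n => Y n ω)
    ha ha_anti ha_sq hC.le h2C hR1 hWC hWL hW0 hKK hstep hB
  obtain ⟨l₁, hl₁⟩ := cauchySeq_tendsto_of_complete h1
  obtain ⟨l₂, hl₂⟩ := cauchySeq_tendsto_of_complete htel
  refine Tendsto.cauchySeq ((hl₁.add hl₂).congr fun n => ?_)
  rw [← Finset.sum_add_distrib]
  refine Finset.sum_congr rfl fun i _ => ?_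
  -- The localised f - h is W(θᵢ, Yᵢ) - q(θᵢ, Yᵢ); adding and subtracting W(θᵢ, Yᵢ₊₁) gives the two
  -- convergent sums.
  rw [← smul_add, mul_smul]
  congr 1
  simp only [hqdef, Pi.smul_apply', smul_add]
  abel

end LocalisedNoise

/-! ### Recurrence from asymptotic tightness. -/

section Tightness

variable {Ω E : Type*} [MeasurableSpace Ω] [TopologicalSpace E] [T2Space E] [MeasurableSpace E]
  [OpensMeasurableSpace E]

/-- Under asymptotic tightness in `G`, with probability at least `1 - 3 ε` the iterates visit
infinitely often a fixed compact subset of `G`. -/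
theorem AsymptoticallyTightIn.exists_compact_measure_not_frequently_le {P : Measure Ω}
    [IsProbabilityMeasure P] {θ : ℕ → Ω → E} (hθ : ∀ n, Measurable (θ n)) {G : Set E}
    (htight : AsymptoticallyTightIn P θ G) (hG : MeasurableSet G)
    (hliminf : liminf (fun n => P.real {ω | θ n ω ∈ G}) atTop = 1) {ε : ℝ} (hε : 0 < ε) :
    ∃ K : Set E, IsCompact K ∧ K ⊆ G ∧
      P {ω | ¬ ∃ᶠ n in atTop, θ n ω ∈ K} ≤ ENNReal.ofReal (3 * ε) := by
  obtain ⟨K, hK, hKG, hlim⟩ := htight ε hε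
  refine ⟨closure (K ∩ G), hK.closure_of_subset Set.inter_subset_left, hKG, ?_⟩
  -- The limsup gives only infinitely many n, with loss 2ε to have a strict inequality; the liminf
  -- for G holds for all large n with loss ε. Together they give 3ε infinitely often.
  have hfreq : ∃ᶠ n in atTop, 1 - 2 * ε < P.real {ω | θ n ω ∈ K} :=
    frequently_lt_of_lt_limsup
      (IsCoboundedUnder.of_frequently_ge (a := 0) (Frequently.of_forall fun n => measureReal_nonneg))
      (by linarith)
  have hev : ∀ᶠ n in atTop, 1 - ε < P.real {ω | θ n ω ∈ G} :=
    eventually_lt_of_lt_liminf (by rw [hliminf]; linarith)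
      (isBoundedUnder_of ⟨0, fun n => measureReal_nonneg⟩)
  have hsmall : ∃ᶠ n in atTop, P {ω | θ n ω ∉ closure (K ∩ G)} ≤ ENNReal.ofReal (3 * ε) := by
    refine (hfreq.and_eventually hev).mono fun n hn => ?_
    have hmK : MeasurableSet {ω | θ n ω ∈ K} := hθ n hK.measurableSet
    have hmG : MeasurableSet {ω | θ n ω ∈ G} := hθ n hG
    have hsub : {ω | θ n ω ∉ closure (K ∩ G)} ⊆ {ω | θ n ω ∈ K}ᶜ ∪ {ω | θ n ω ∈ G}ᶜ := by
      intro ω hω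
      by_contra hcon
      simp only [Set.mem_union, Set.mem_compl_iff, Set.mem_ofPred_eq, not_or, not_not] at hcon
      exact hω (subset_closure hcon)
    rw [← ofReal_measureReal]
    refine ENNReal.ofReal_le_ofReal ((measureReal_mono hsub).trans
      ((measureReal_union_le _ _).trans ?_))
    rw [probReal_compl_eq_one_sub hmK, probReal_compl_eq_one_sub hmG]
    linarith [hn.1, hn.2]
  have hset : {ω | ¬ ∃ᶠ n in atTop, θ n ω ∈ closure (K ∩ G)}
      = ⋃ N, ⋂ n ≥ N, {ω | θ n ω ∉ closure (K ∩ G)} := by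
    ext ω
    simp [not_frequently, eventually_atTop]
  -- Continuity from below reduces the union to each fixed N, where one good index n ≥ N bounds the
  -- whole intersection.
  have hmono : Monotone fun N : ℕ => ⋂ n ≥ N, {ω | θ n ω ∉ closure (K ∩ G)} :=
    fun N N' hN => Set.biInter_mono (fun n (hn : N' ≤ n) => hN.trans hn) fun _ _ => le_rfl
  rw [hset, hmono.measure_iUnion]
  refine iSup_le fun N => ?_
  obtain ⟨n, hn, hle⟩ := frequently_atTop.1 hsmall N
  exact (measure_mono (Set.biInter_subset_of_mem hn)).trans hle

end Tightness

end StochApprox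

/-! ### The almost sure convergence theorem. -/

theorem mainTheorem2 {d : ℕ}
    {Ω : Type*} {m₀ : MeasurableSpace Ω} (P : Measure Ω) [IsProbabilityMeasure P]
    (ℱ : Filtration ℕ m₀)
    -- iterates, Markov noise, martingale noise, all adapted to the filtration
    (θ Y M : ℕ → Ω → EuclideanSpace ℝ (Fin d))
    (hθ : ∀ n, Measurable[ℱ n] (θ n)) (hY : ∀ n, Measurable[ℱ n] (Y n))
    (hM : StochApprox.IsMartingaleDifference P ℱ M)
    -- transition kernels, `Q (ϑ, y)` being `Π_ϑ(y; ·)`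
    (Q : Kernel (EuclideanSpace ℝ (Fin d) × EuclideanSpace ℝ (Fin d)) (EuclideanSpace ℝ (Fin d)))
    [IsMarkovKernel Q]
    (hQ : StochApprox.IsIterateDependentMarkov P ℱ Q θ Y)
    -- the recursion
    (f : EuclideanSpace ℝ (Fin d) → EuclideanSpace ℝ (Fin d) → EuclideanSpace ℝ (Fin d))
    (hf : Measurable (Function.uncurry f))
    (a : ℕ → ℝ)
    (hrec : ∀ n ω, θ (n + 1) ω = θ n ω + a n • (f (θ n ω) (Y n ω) + M (n + 1) ω))
    -- almost sure asymptotic bound and second moment bound on the Markov noise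
    (hY_limsup : ∃ C : ℝ≥0, ∀ᵐ ω ∂P, limsup (fun n => ‖Y n ω‖ₑ) atTop < (C : ℝ≥0∞))
    (hY_moment : limsup (fun n => ∫⁻ ω, ‖Y n ω‖ₑ ^ 2 ∂P) atTop < ∞)
    -- linear growth of `f`, uniformly in the noise variable
    (hf_growth : ∃ K : ℝ, ∀ ϑ y, ‖f ϑ y‖ ≤ K * (1 + ‖ϑ‖))
    -- step sizes
    (ha_pos : ∀ n, 0 < a n) (ha_anti : Antitone a)
    (ha_sum : Tendsto (fun n => ∑ i ∈ Finset.range n, a i) atTop atTop)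
    (ha_sq : Summable (fun n => a n ^ 2))
    -- unique invariant probabilities and the Lipschitz averaged field `h`
    (Γ : EuclideanSpace ℝ (Fin d) → Measure (EuclideanSpace ℝ (Fin d)))
    (hΓ_inv : ∀ ϑ, StochApprox.IsInvariantProb (Q.sectR ϑ) (Γ ϑ))
    (hΓ_unique : ∀ ϑ π, StochApprox.IsInvariantProb (Q.sectR ϑ) π → π = Γ ϑ)
    (h : EuclideanSpace ℝ (Fin d) → EuclideanSpace ℝ (Fin d))
    (hh : ∀ ϑ, h ϑ = ∫ y, f ϑ y ∂(Γ ϑ))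
    (hh_lip : ∃ L : ℝ≥0, LipschitzWith L h)
    -- bound on the martingale noise
    (hM_bound : ∃ K' : ℝ, ∀ n, ∀ᵐ ω ∂P, ‖M (n + 1) ω‖ ≤ K' * (1 + ‖θ n ω‖))
    -- Poisson equation
    (v : EuclideanSpace ℝ (Fin d) → EuclideanSpace ℝ (Fin d) → EuclideanSpace ℝ (Fin d))
    (hv_poisson : ∀ ϑ, StochApprox.SolvesPoisson (Q.sectR ϑ) (fun y => f ϑ y - ∫ z, f ϑ z ∂(Γ ϑ)) (v ϑ))
    -- local bounds on the solutions of the Poisson equation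
    (hv_bound : ∀ R : ℝ, 0 < R → ∃ C : ℝ, 0 < C ∧
      (∀ ϑ x, ‖ϑ‖ ≤ R → ‖v ϑ x‖ ≤ C * (1 + ‖x‖)) ∧
      (∀ ϑ ϑ' x, ‖ϑ‖ ≤ R → ‖ϑ'‖ ≤ R → ‖v ϑ x - v ϑ' x‖ ≤ C * ‖ϑ - ϑ'‖ * (1 + ‖x‖)))
    -- the attractor `H`, its strict Lyapunov function on `G`, and `G` in its domain of attraction
    (G H : Set (EuclideanSpace ℝ (Fin d))) (V : EuclideanSpace ℝ (Fin d) → ℝ)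
    (hV : StochApprox.IsStrictLyapunov h G V H)
    (hG : G ⊆ StochApprox.domainOfAttraction h H)
    -- asymptotic tightness, and the iterates lie in `G` with probability tending to one
    (htight : StochApprox.AsymptoticallyTightIn P θ G)
    (hliminf : liminf (fun n => P.real {ω | θ n ω ∈ G}) atTop = 1) :
    ∀ᵐ ω ∂P, StochApprox.ConvergesTo (fun n => θ n ω) atTop H := by

  obtain ⟨L, hL⟩ := hh_lip
  simp_rw [← hh] at hv_poisson
  -- Integer radii keep the exceptional sets countable in number, so one null set serves all radii.
  have hnoise : ∀ᵐ ω ∂P, ∀ R : ℕ, CauchySeq fun n => ∑ i ∈ Finset.range n,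
      (a i * StochApprox.cutoff R (θ i ω)) •
        (f (θ i ω) (Y i ω) - h (θ i ω) + M (i + 1) ω) :=
    ae_all_iff.2 fun R => StochApprox.ae_cauchySeq_sum_localised_noise hθ hY hM hQ hrec hY_limsup
      hY_moment hf_growth ha_pos ha_anti ha_sq hL hM_bound hv_poisson hv_bound R.cast_nonneg
  have hconv : ∀ K : Set (EuclideanSpace ℝ (Fin d)), IsCompact K → K ⊆ G →
      ∀ᵐ ω ∂P, (∃ᶠ n in atTop, θ n ω ∈ K) →
        StochApprox.ConvergesTo (fun n => θ n ω) atTop H := fun K hK hKG => by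
    filter_upwards [hnoise] with ω hω hfreq
    refine StochApprox.euler_scheme_convergesTo hL ha_pos ha_sum ha_sq (fun n => ?_) hω hV hG hK
      hKG hfreq
    rw [hrec, ← add_assoc, add_sub_cancel]
  rw [ae_iff]
  refine le_antisymm (le_of_forall_gt fun c hc => ?_) zero_le
  obtain ⟨r, hr0, hrc⟩ := ENNReal.lt_iff_exists_nnreal_btwn.1 hc
  have hr : (0 : ℝ) < r := by exact_mod_cast hr0
  obtain ⟨K, hK, hKG, hle⟩ := htight.exists_compact_measure_not_frequently_le
    (fun n => (hθ n).mono (ℱ.le n) le_rfl) hV.isOpen.measurableSet hliminf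
    (by positivity : (0 : ℝ) < r / 3)
  refine lt_of_le_of_lt (measure_mono_ae ?_) (hle.trans_lt ?_)
  · filter_upwards [hconv K hK hKG] with ω hω hbad hfreq
    exact hbad (hω hfreq)
  · rwa [mul_div_cancel₀ _ (by norm_num), ENNReal.ofReal_coe_nnreal]
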